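/- Let $p,q\ge 0$ with $p+q\le 9$, and let $Cl_{p,q}$ be the real Clifford algebra with generators $e_1,\dots,e_n$, $n=p+q$, where $e_i^2=1$ for $i\le p$, $e_i^2=-1$ for $i>p$ and $e_ie_j=-e_je_i$ for $i\ne j$. For $I=\{i_1<\dots<i_s\}$ write $e_I=e_{i_1}\cdots e_{i_s}$ (also $e_{i_1\dots i_s}$), and let $G_{p,q}=\{\pm e_I\}$ be the vee group under the Clifford product. Let $r_i$ $(i\in\mathbb Z)$ be the Radon–Hurwitz numbers: $r_0,\dots,r_7=0,1,2,2,3,3,3,3$ and $r_{i+8}=r_i+4$. Put $k=q-r_{q-p}$. Suppose $p-q\not\equiv 1 \pmod 4$ (so that $Cl_{p,q}$ is simple). Let $e_{I_1},\dots,e_{I_k}$ be commuting basis monomials with square $1$ that generate a group of order $2^k$, and suppose that, for some choice of signs, $$f=\tfrac12(1\pm e_{I_1})\,\tfrac12(1\pm e_{I_2})\cdots\tfrac12(1\pm e_{I_k})$$ is a primitive idempotent. Let $G_{p,q}(f)=\{g\in G_{p,q}: gfg^{-1}=f\}$. Let $F_2=\langle e_2,e_3\rangle\subset G_{1,3}$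 and $F_3=\langle e_1,e_2,e_3\rangle\subset G_{0,4}$. Then: (i) $G_{p,q}(f)$ is a normal subgroup of $G_{p,q}$ of order $2^{1+p+r_{q-p}}$. (ii) $G_{p,q}(f)$ is an abelian $2$-group if $p-q\equiv 0,1,2\pmod 8$ (real case) or $p-q\equiv 3,7\pmod 8$ (complex case), and a non-abelian $2$-group if $p-q\equiv 4,5,6\pmod 8$ (quaternionic case). (iii) $G_{p,q}(f)$ is generated by $s$ elements $g_1,\dots,g_s$, each of order $2$ or $4$, where $s=k+1$ in the real and complex cases and $s=k+2$ in the quaternionic case. (iv) $G_{p,q}(f)$ is isomorphic to $(\mathbb Z/2)^{k+1}$ in the real case, to $(\mathbb Z/2)^k\times\mathbb Z/4$ in the complex case, and to $F_2\times(\mathbb Z/2)^k$ in the quaternionic case. (v) Every $m\in G_{p,q}(f)$ satisfies $m e_{I_j}m^{-1}=e_{I_j}$ for $j=1,\dots,k$. Moreover, in each of the following cases the listed monomials $e_{I_1},\dots,e_{I_k}$ commute, have square $1$, generate a group of order $2^k$, and number $k=q-r_{q-p}$; and for $f=\frac12(1+e_{I_1})\cdots\frac12(1+e_{I_k})$ the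 stabilizer $G_{p,q}(f)$ is as described. Real case. $G_{p,q}(f)=\langle -1,e_{I_1},\dots,e_{I_k}\rangle\cong(\mathbb Z/2)^{k+1}$, where all $k+1$ generators have order $2$: - $(p,q)=(1,1)$: $\{e_{12}\}$. - $(p,q)=(2,0)$: $\{e_{1}\}$. - $(p,q)=(2,2)$: $\{e_{13}, e_{24}\}$. - $(p,q)=(3,1)$: $\{e_{1}, e_{34}\}$. - $(p,q)=(0,6)$: $\{e_{123}, e_{146}, e_{345}\}$. - $(p,q)=(3,3)$: $\{e_{14}, e_{25}, e_{36}\}$. - $(p,q)=(4,2)$: $\{e_{1}, e_{35}, e_{46}\}$. - $(p,q)=(0,8)$: $\{e_{123}, e_{146}, e_{345}, e_{367}\}$. - $(p,q)=(1,7)$: $\{e_{18}, e_{234}, e_{257}, e_{456}\}$. - $(p,q)=(4,4)$: $\{e_{15}, e_{26}, e_{37}, e_{48}\}$. - $(p,q)=(5,3)$: $\{e_{1}, e_{36}, e_{47}, e_{58}\}$. - $(p,q)=(8,0)$: $\{e_{1}, e_{2345}, e_{2468}, e_{4567}\}$. Complex case. $G_{p,q}(f)\cong(\mathbb Z/2)^k\times\mathbb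 Z/4$ is generated by the elements listed second, which have the orders listed third: - $(p,q)=(1,2)$: $\{e_{13}\}$; $\langle e_{2}, e_{13}\rangle$; orders $(4,2)$. - $(p,q)=(3,0)$: $\{e_{1}\}$; $\langle e_{1}, e_{23}\rangle$; orders $(2,4)$. - $(p,q)=(0,5)$: $\{e_{123}, e_{345}\}$; $\langle e_{3}, e_{12}, e_{45}\rangle$; orders $(4,4,4)$. - $(p,q)=(2,3)$: $\{e_{14}, e_{25}\}$; $\langle e_{3}, e_{14}, e_{25}\rangle$; orders $(4,2,2)$. - $(p,q)=(4,1)$: $\{e_{1}, e_{45}\}$; $\langle e_{1}, e_{23}, e_{45}\rangle$; orders $(2,4,2)$. - $(p,q)=(1,6)$: $\{e_{17}, e_{234}, e_{456}\}$; $\langle e_{4}, e_{17}, e_{23}, e_{56}\rangle$; orders $(4,2,4,4)$. - $(p,q)=(3,4)$: $\{e_{15}, e_{26}, e_{37}\}$; $\langle e_{4}, e_{15}, e_{26}, e_{37}\rangle$; orders $(4,2,2,2)$. - $(p,q)=(5,2)$: $\{e_{1}, e_{46}, e_{57}\}$; $\langle e_{1}, e_{23}, e_{46}, e_{57}\rangle$;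 orders $(2,4,2,2)$. - $(p,q)=(7,0)$: $\{e_{1}, e_{2345}, e_{4567}\}$; $\langle e_{1}, e_{23}, e_{45}, e_{67}\rangle$; orders $(2,4,4,4)$. - $(p,q)=(0,9)$: $\{e_{123}, e_{146}, e_{345}, e_{367}\}$; $\langle e_{89}, e_{123}, e_{146}, e_{157}, e_{256}\rangle$; orders $(4,2,2,2,2)$. - $(p,q)=(2,7)$: $\{e_{18}, e_{29}, e_{345}, e_{567}\}$; $\langle e_{5}, e_{18}, e_{29}, e_{34}, e_{67}\rangle$; orders $(4,2,2,4,4)$. - $(p,q)=(4,5)$: $\{e_{16}, e_{27}, e_{38}, e_{49}\}$; $\langle e_{5}, e_{16}, e_{27}, e_{38}, e_{49}\rangle$; orders $(4,2,2,2,2)$. - $(p,q)=(6,3)$: $\{e_{1}, e_{47}, e_{58}, e_{69}\}$; $\langle e_{1}, e_{23}, e_{47}, e_{58}, e_{69}\rangle$; orders $(2,4,2,2,2)$. - $(p,q)=(8,1)$: $\{e_{1}, e_{89}, e_{2345}, e_{4567}\}$; $\langle e_{1}, e_{23}, e_{45}, e_{67}, e_{89}\rangle$; orders $(2,4,4,4,2)$.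 Quaternionic case. $G_{p,q}(f)$ is generated by the elements listed second, which have the orders listed third, and it is isomorphic to the group listed last: - $(p,q)=(0,4)$: $\{e_{123}\}$; $\langle e_{1}, e_{2}, e_{3}\rangle$; orders $(4,4,4)$; $F_3$. - $(p,q)=(1,3)$: $\{e_{14}\}$; $\langle e_{2}, e_{3}, e_{14}\rangle$; orders $(4,4,2)$; $F_2\times\mathbb Z/2$. - $(p,q)=(4,0)$: $\{e_{1}\}$; $\langle e_{1}, e_{23}, e_{24}\rangle$; orders $(2,4,4)$; $F_2\times\mathbb Z/2$. - $(p,q)=(1,5)$: $\{e_{16}, e_{234}\}$; $\langle e_{2}, e_{3}, e_{4}, e_{16}\rangle$; orders $(4,4,4,2)$; $F_3\times\mathbb Z/2$. - $(p,q)=(2,4)$: $\{e_{15}, e_{26}\}$; $\langle e_{3}, e_{4}, e_{15}, e_{26}\rangle$; orders $(4,4,2,2)$; $F_2\times(\mathbb Z/2)^2$. - $(p,q)=(5,1)$: $\{e_{1}, e_{56}\}$; $\langle e_{1}, e_{23}, e_{24}, e_{56}\rangle$; orders $(2,4,4,2)$; $F_2\times(\mathbb Z/2)^2$. - $(p,q)=(6,0)$: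 $\{e_{1}, e_{2345}\}$; $\langle e_{1}, e_{23}, e_{24}, e_{25}\rangle$; orders $(2,4,4,4)$; $F_3\times\mathbb Z/2$. - $(p,q)=(2,6)$: $\{e_{17}, e_{28}, e_{345}\}$; $\langle e_{3}, e_{4}, e_{5}, e_{17}, e_{28}\rangle$; orders $(4,4,4,2,2)$; $F_3\times(\mathbb Z/2)^2$. - $(p,q)=(3,5)$: $\{e_{16}, e_{27}, e_{38}\}$; $\langle e_{4}, e_{5}, e_{16}, e_{27}, e_{38}\rangle$; orders $(4,4,2,2,2)$; $F_2\times(\mathbb Z/2)^3$. - $(p,q)=(6,2)$: $\{e_{1}, e_{57}, e_{68}\}$; $\langle e_{1}, e_{23}, e_{34}, e_{57}, e_{68}\rangle$; orders $(2,4,4,2,2)$; $F_2\times(\mathbb Z/2)^3$. - $(p,q)=(7,1)$: $\{e_{1}, e_{78}, e_{2345}\}$; $\langle e_{1}, e_{23}, e_{24}, e_{25}, e_{78}\rangle$; orders $(2,4,4,4,2)$; $F_3\times(\mathbb Z/2)^2$. Here $|F_2|=8$, $|F_3|=16$, and $F_2$ is a normal subgroup of $G_{1,3}(f)$ for $f=\frac12(1+e_{14})$.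 -/

import Mathlib

noncomputable section

namespace VeeStab

/-- The Radon-Hurwitz numbers `r_i`, `i ∈ ℤ`: `r_0, …, r_7 = 0, 1, 2, 2, 3, 3, 3, 3` and
`r_{i+8} = r_i + 4`. -/
def radonHurwitz (i : ℤ) : ℤ :=
  4 * (i / 8) +
    (if i % 8 = 0 then 0 else if i % 8 = 1 then 1 else if i % 8 = 2 ∨ i % 8 = 3 then 2 else 3)

theorem radonHurwitz_initial :
    radonHurwitz 0 = 0 ∧ radonHurwitz 1 = 1 ∧ radonHurwitz 2 = 2 ∧ radonHurwitz 3 = 2 ∧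
      radonHurwitz 4 = 3 ∧ radonHurwitz 5 = 3 ∧ radonHurwitz 6 = 3 ∧ radonHurwitz 7 = 3 := by
  decide

theorem radonHurwitz_add_eight (i : ℤ) : radonHurwitz (i + 8) = radonHurwitz i + 4 := by
  have h1 : (i + 8) % 8 = i % 8 := by omega
  have h2 : (i + 8) / 8 = i / 8 + 1 := by omega
  unfold radonHurwitz
  rw [h1, h2]
  ring

/-- The standard quadratic form of signature `(p, q)` on `ℝ^{p+q}`: the first `p` basis vectors
have square `1`, the last `q` have square `-1`. -/
abbrev form (p q : ℕ) : QuadraticForm ℝ (Fin (p + q) → ℝ) :=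
  QuadraticMap.weightedSumSquares ℝ (fun i : Fin (p + q) => if (i : ℕ) < p then (1 : ℝ) else -1)

/-- The real Clifford algebra `Cl_{p,q}`. -/
abbrev Cl (p q : ℕ) : Type := CliffordAlgebra (form p q)

/-- The generators `e_1, …, e_n` of `Cl_{p,q}`, indexed from `0`. -/
def e (p q : ℕ) (i : Fin (p + q)) : Cl p q :=
  CliffordAlgebra.ι (form p q) (Pi.single i 1)

/-- The basis monomial `e_I`: the product of the `e_i`, `i ∈ I`, in increasing order
(the factors with `i ∉ I` are `1`). -/
def monomial (p q : ℕ) (I : Finset (Fin (p + q))) : Cl p q :=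
  ((List.finRange (p + q)).map fun i => if i ∈ I then e p q i else 1).prod

theorem e_mul_self (p q : ℕ) (i : Fin (p + q)) :
    e p q i * e p q i = 1 ∨ e p q i * e p q i = -1 := by
  have h : form p q (Pi.single i 1) = if (i : ℕ) < p then (1 : ℝ) else -1 := by
    rw [QuadraticMap.weightedSumSquares_apply, Finset.sum_eq_single i]
    · simp
    · intro j _ hj
      simp [Pi.single_eq_of_ne hj]
    · simp
  unfold e
  rw [CliffordAlgebra.ι_sq_scalar, h]
  split_ifs
  · left; simp
  · right; simp

theorem e_mul_e (p q : ℕ) {i j : Fin (p + q)} (hij : i ≠ j) :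
    e p q i * e p q j = -(e p q j * e p q i) := by
  refine CliffordAlgebra.ι_mul_ι_comm_of_isOrtho ?_
  rw [QuadraticMap.isOrtho_def]
  simp only [QuadraticMap.weightedSumSquares_apply]
  rw [← Finset.sum_add_distrib]
  refine Finset.sum_congr rfl fun l _ => ?_
  by_cases hl : l = i
  · subst hl
    simp [Pi.single_eq_of_ne hij]
  · simp [Pi.single_eq_of_ne hl]

/-- Equality up to sign. -/
def SignEq {A : Type*} [Ring A] (a b : A) : Prop := a = b ∨ a = -b

theorem SignEq.trans {A : Type*} [Ring A] {a b c : A} (h : SignEq a b) (h' : SignEq b c) :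
    SignEq a c := by
  rcases h with rfl | rfl <;> rcases h' with rfl | rfl <;> simp [SignEq]

theorem SignEq.mul {A : Type*} [Ring A] {a b c d : A} (h : SignEq a b) (h' : SignEq c d) :
    SignEq (a * c) (b * d) := by
  rcases h with rfl | rfl <;> rcases h' with rfl | rfl <;> simp [SignEq]

theorem signEq_refl {A : Type*} [Ring A] (a : A) : SignEq a a := Or.inl rfl

theorem signEq_prod_comm {A ι : Type*} [Ring A] (y : A) (f : ι → A) (l : List ι)
    (h : ∀ i ∈ l, SignEq (f i * y) (y * f i)) :
    SignEq ((l.map f).prod * y) (y * (l.map f).prod) := by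
  induction l with
  | nil => simp [SignEq]
  | cons a l ih =>
    have h1 := ih fun i hi => h i (List.mem_cons_of_mem _ hi)
    have h2 := h a List.mem_cons_self
    simp only [List.map_cons, List.prod_cons]
    have h3 := (signEq_refl (f a)).mul h1
    have h4 := h2.mul (signEq_refl ((l.map f).prod))
    simp only [mul_assoc] at h3 h4 ⊢
    exact h3.trans h4

theorem signEq_prod_mul {A ι : Type*} [Ring A] (f g h : ι → A) (l : List ι) (hl : l.Nodup)
    (hc : ∀ i j, i ≠ j → SignEq (f i * g j) (g j * f i))
    (hm : ∀ i, SignEq (f i * g i) (h i)) :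
    SignEq ((l.map f).prod * (l.map g).prod) (l.map h).prod := by
  induction l with
  | nil => simp [SignEq]
  | cons a l ih =>
    rw [List.nodup_cons] at hl
    have h1 := ih hl.2
    have h2 := signEq_prod_comm (g a) f l fun i hi =>
      hc i a (by rintro rfl; exact hl.1 hi)
    simp only [List.map_cons, List.prod_cons]
    have h3 := ((signEq_refl (f a)).mul h2).mul (signEq_refl (l.map g).prod)
    have h4 := (hm a).mul h1
    simp only [mul_assoc] at h3 h4 ⊢
    exact h3.trans h4

theorem monomial_mul (p q : ℕ) (I J : Finset (Fin (p + q))) :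
    SignEq (monomial p q I * monomial p q J) (monomial p q (symmDiff I J)) := by
  refine signEq_prod_mul _ _ _ _ (List.nodup_finRange _) ?_ ?_
  · intro i j hij
    split_ifs
    · exact Or.inr (e_mul_e p q hij)
    all_goals simp [SignEq]
  · intro i
    by_cases h1 : i ∈ I <;> by_cases h2 : i ∈ J <;> simp [Finset.mem_symmDiff, h1, h2, SignEq]
    exact e_mul_self p q i

theorem monomial_empty (p q : ℕ) : monomial p q ∅ = 1 := by
  simp [monomial]

theorem monomial_mul_self (p q : ℕ) (I : Finset (Fin (p + q))) :
    monomial p q I * monomial p q I = 1 ∨ monomial p q I * monomial p q I = -1 := by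
  have h := monomial_mul p q I I
  rw [symmDiff_self, Finset.bot_eq_empty, monomial_empty] at h
  exact h

/-- The Salingaros vee group `G_{p,q} = {± e_I}` under the Clifford product. -/
def veeGroup (p q : ℕ) : Subgroup (Cl p q)ˣ where
  carrier := {u | ∃ I : Finset (Fin (p + q)),
    (u : Cl p q) = monomial p q I ∨ (u : Cl p q) = -monomial p q I}
  one_mem' := ⟨∅, Or.inl (by simp [monomial_empty])⟩
  mul_mem' := by
    rintro a b ⟨I, hI⟩ ⟨J, hJ⟩
    refine ⟨symmDiff I J, ?_⟩
    have h := (SignEq.mul hI hJ).trans (monomial_mul p q I J)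
    simpa [SignEq] using h
  inv_mem' := by
    rintro u ⟨I, hI⟩
    refine ⟨I, ?_⟩
    have h : (u : Cl p q) * u = 1 ∨ (u : Cl p q) * u = -1 := by
      rcases hI with h | h <;> rw [h] <;> simpa using monomial_mul_self p q I
    have hu : u⁻¹ = u ∨ u⁻¹ = -u := by
      rcases h with h | h
      · left
        exact inv_eq_of_mul_eq_one_right (Units.ext (by simpa using h))
      · right
        exact inv_eq_of_mul_eq_one_right (Units.ext (by simp [h]))
    rcases hu with h | h <;> rw [h] <;> rcases hI with h' | h' <;> simp [h']

theorem isUnit_monomial (p q : ℕ) (I : Finset (Fin (p + q))) : IsUnit (monomial p q I) := by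
  rcases monomial_mul_self p q I with h | h
  · exact ⟨⟨_, _, h, h⟩, rfl⟩
  · exact ⟨⟨monomial p q I, -monomial p q I, by simp [h], by simp [h]⟩, rfl⟩

/-- The basis monomial `e_I` as an element of `G_{p,q}`. -/
def veeMonomial (p q : ℕ) (I : Finset (Fin (p + q))) : veeGroup p q :=
  ⟨(isUnit_monomial p q I).unit, I, Or.inl rfl⟩

/-- The element `-1` of `G_{p,q}`. -/
def veeNegOne (p q : ℕ) : veeGroup p q :=
  ⟨-1, ∅, Or.inr (by simp [monomial_empty])⟩

/-- The stabilizer `G_{p,q}(f)` of `f` under the conjugation action of `G_{p,q}`. -/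
def stab (p q : ℕ) (f : Cl p q) : Subgroup (veeGroup p q) where
  carrier := {g | ((g : (Cl p q)ˣ) : Cl p q) * f * (((g : (Cl p q)ˣ)⁻¹ : (Cl p q)ˣ) : Cl p q) = f}
  one_mem' := by simp
  mul_mem' := by
    intro a b ha hb
    simp only [Set.mem_ofPred_eq, Subgroup.coe_mul, mul_inv_rev, Units.val_mul] at *
    calc _ = ((a : (Cl p q)ˣ) : Cl p q) *
          (((b : (Cl p q)ˣ) : Cl p q) * f * (((b : (Cl p q)ˣ)⁻¹ : (Cl p q)ˣ) : Cl p q)) *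
          (((a : (Cl p q)ˣ)⁻¹ : (Cl p q)ˣ) : Cl p q) := by simp only [mul_assoc]
      _ = f := by rw [hb, ha]
  inv_mem' := by
    intro a ha
    simp only [Set.mem_ofPred_eq, Subgroup.coe_inv, inv_inv] at *
    conv_lhs => rw [← ha]
    simp [mul_assoc]

/-- A primitive idempotent of a ring: a nonzero idempotent that is not the sum of two nonzero
orthogonal idempotents. -/
def IsPrimitiveIdempotent {A : Type*} [Ring A] (f : A) : Prop :=
  f ≠ 0 ∧ f * f = f ∧
    ∀ a b : A, a * a = a → b * b = b → a * b = 0 → b * a = 0 → f = a + b → a = 0 ∨ b = 0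

/-- The product `½(1 ± e_{I_1}) ½(1 ± e_{I_2}) ⋯ ½(1 ± e_{I_k})`. -/
def productElt (p q : ℕ) {k : ℕ} (I : Fin k → Finset (Fin (p + q))) (ε : Fin k → ℤˣ) : Cl p q :=
  (List.ofFn fun j => (1 / 2 : ℝ) • (1 + ((ε j : ℤˣ) : ℤ) • monomial p q (I j))).prod

/-- `e_{I_1}, …, e_{I_k}` are commuting basis monomials with square `1` which generate a group of
order `2^k`. -/
structure IsCommutingFamily (p q : ℕ) {k : ℕ} (I : Fin k → Finset (Fin (p + q))) : Prop where
  sq_eq_one : ∀ j, monomial p q (I j) * monomial p q (I j) = 1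
  comm : ∀ i j, monomial p q (I i) * monomial p q (I j) = monomial p q (I j) * monomial p q (I i)
  card : Nat.card (Subgroup.closure (Set.range fun j => veeMonomial p q (I j))) = 2 ^ k

/-- `(ℤ/m)^a`, written multiplicatively. -/
abbrev CyclicPower (m a : ℕ) : Type := Fin a → Multiplicative (ZMod m)

/-- The set of (zero-based) indices given by a list of one-based indices. -/
def idx (p q : ℕ) (l : List ℕ) : Finset (Fin (p + q)) :=
  Finset.univ.filter fun i => (i : ℕ) + 1 ∈ l

/-- `F_2 = ⟨e_2, e_3⟩` inside `G_{1,3}`. -/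
def F2 : Subgroup (veeGroup 1 3) :=
  Subgroup.closure {veeMonomial 1 3 (idx 1 3 [2]), veeMonomial 1 3 (idx 1 3 [3])}

/-- `F_3 = ⟨e_1, e_2, e_3⟩` inside `G_{0,4}`. -/
def F3 : Subgroup (veeGroup 0 4) :=
  Subgroup.closure {veeMonomial 0 4 (idx 0 4 [1]), veeMonomial 0 4 (idx 0 4 [2]),
    veeMonomial 0 4 (idx 0 4 [3])}

/-- The isomorphism types in the tables: `(ℤ/2)^a`, `(ℤ/2)^a × ℤ/4`, `F_2 × (ℤ/2)^a`,
`F_3 × (ℤ/2)^a`. -/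
inductive GroupShape where
  | elementary (a : ℕ)
  | withC4 (a : ℕ)
  | f2 (a : ℕ)
  | f3 (a : ℕ)

/-- The group `H` has the given isomorphism type. -/
def GroupShape.Describes (s : GroupShape) (H : Type) [Group H] : Prop :=
  match s with
  | .elementary a => Nonempty (H ≃* CyclicPower 2 a)
  | .withC4 a => Nonempty (H ≃* CyclicPower 2 a × Multiplicative (ZMod 4))
  | .f2 a => Nonempty (H ≃* F2 × CyclicPower 2 a)
  | .f3 a => Nonempty (H ≃* F3 × CyclicPower 2 a)

/-- A row of the tables. All indices of the `e_i` are one-based. -/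
structure TableRow where
  /-- The signature. -/
  p : ℕ
  q : ℕ
  /-- The monomials `e_{I_1}, …, e_{I_k}` with `f = ½(1 + e_{I_1}) ⋯ ½(1 + e_{I_k})`. -/
  monomials : List (List ℕ)
  /-- The listed generators of the stabilizer; `none` is `-1` and `some l` is `e_l`. -/
  gens : List (Option (List ℕ))
  /-- The listed orders of the generators. -/
  orders : List ℕ
  /-- The isomorphism type. -/
  shape : GroupShape

/-- The family `I_1, …, I_k` of a row. -/
def TableRow.family (R : TableRow) (j : Fin R.monomials.length) : Finset (Fin (R.p + R.q)) :=
  idx R.p R.q (R.monomials.get j)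

/-- The idempotent of a row (all signs are plus). -/
def TableRow.idem (R : TableRow) : Cl R.p R.q := productElt R.p R.q R.family fun _ => 1

/-- The listed generators of a row, as elements of `G_{p,q}`. -/
def TableRow.genElts (R : TableRow) : List (veeGroup R.p R.q) :=
  R.gens.map fun o => match o with
    | none => veeNegOne R.p R.q
    | some l => veeMonomial R.p R.q (idx R.p R.q l)

/-- Everything a row says about its idempotent `f` and about `G_{p,q}(f)`: the monomials of `f` are
as required, there are `k = q - r_{q-p}` of them, the listed elements generate `G_{p,q}(f)`, they
have the listed orders, and `G_{p,q}(f)` has the listed isomorphism type. -/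
structure TableRow.Correct (R : TableRow) : Prop where
  family : IsCommutingFamily R.p R.q R.family
  length : (R.monomials.length : ℤ) = (R.q : ℤ) - radonHurwitz ((R.q : ℤ) - R.p)
  gens : Subgroup.closure {g | g ∈ R.genElts} = stab R.p R.q R.idem
  orders : R.genElts.map orderOf = R.orders
  shape : R.shape.Describes (stab R.p R.q R.idem)

/-- Rows of the real table: the generators are `-1` and the monomials of `f`, all of order `2`,
and the stabilizer is `(ℤ/2)^{k+1}`. -/
def realRow (p q : ℕ) (T : List (List ℕ)) : TableRow :=
  ⟨p, q, T, none :: T.map some, List.replicate (T.length + 1) 2, .elementary (T.length + 1)⟩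

/-- Rows of the complex table: the stabilizer is `(ℤ/2)^k × ℤ/4`. -/
def complexRow (p q : ℕ) (T : List (List ℕ)) (gens : List (List ℕ)) (orders : List ℕ) :
    TableRow :=
  ⟨p, q, T, gens.map some, orders, .withC4 T.length⟩

/-- Rows of the quaternionic table. -/
def quaternionicRow (p q : ℕ) (T : List (List ℕ)) (gens : List (List ℕ)) (orders : List ℕ)
    (s : GroupShape) : TableRow :=
  ⟨p, q, T, gens.map some, orders, s⟩

/-- Tabulated idempotents and stabilizers for `Cl_{p,q} ≅ Mat(2^k, ℝ)`. -/
def realTable : List TableRow :=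
  [ realRow 1 1 [[1, 2]],
    realRow 2 0 [[1]],
    realRow 2 2 [[1, 3], [2, 4]],
    realRow 3 1 [[1], [3, 4]],
    realRow 0 6 [[1, 2, 3], [1, 4, 6], [3, 4, 5]],
    realRow 3 3 [[1, 4], [2, 5], [3, 6]],
    realRow 4 2 [[1], [3, 5], [4, 6]],
    realRow 0 8 [[1, 2, 3], [1, 4, 6], [3, 4, 5], [3, 6, 7]],
    realRow 1 7 [[1, 8], [2, 3, 4], [2, 5, 7], [4, 5, 6]],
    realRow 4 4 [[1, 5], [2, 6], [3, 7], [4, 8]],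
    realRow 5 3 [[1], [3, 6], [4, 7], [5, 8]],
    realRow 8 0 [[1], [2, 3, 4, 5], [2, 4, 6, 8], [4, 5, 6, 7]] ]

/-- Tabulated idempotents and stabilizers for `Cl_{p,q} ≅ Mat(2^k, ℂ)`. -/
def complexTable : List TableRow :=
  [ complexRow 1 2 [[1, 3]]
      [[2], [1, 3]] [4, 2],
    complexRow 3 0 [[1]]
      [[1], [2, 3]] [2, 4],
    complexRow 0 5 [[1, 2, 3], [3, 4, 5]]
      [[3], [1, 2], [4, 5]] [4, 4, 4],
    complexRow 2 3 [[1, 4], [2, 5]]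
      [[3], [1, 4], [2, 5]] [4, 2, 2],
    complexRow 4 1 [[1], [4, 5]]
      [[1], [2, 3], [4, 5]] [2, 4, 2],
    complexRow 1 6 [[1, 7], [2, 3, 4], [4, 5, 6]]
      [[4], [1, 7], [2, 3], [5, 6]] [4, 2, 4, 4],
    complexRow 3 4 [[1, 5], [2, 6], [3, 7]]
      [[4], [1, 5], [2, 6], [3, 7]] [4, 2, 2, 2],
    complexRow 5 2 [[1], [4, 6], [5, 7]]
      [[1], [2, 3], [4, 6], [5, 7]] [2, 4, 2, 2],
    complexRow 7 0 [[1], [2, 3, 4, 5], [4, 5, 6, 7]]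
      [[1], [2, 3], [4, 5], [6, 7]] [2, 4, 4, 4],
    complexRow 0 9 [[1, 2, 3], [1, 4, 6], [3, 4, 5], [3, 6, 7]]
      [[8, 9], [1, 2, 3], [1, 4, 6], [1, 5, 7], [2, 5, 6]] [4, 2, 2, 2, 2],
    complexRow 2 7 [[1, 8], [2, 9], [3, 4, 5], [5, 6, 7]]
      [[5], [1, 8], [2, 9], [3, 4], [6, 7]] [4, 2, 2, 4, 4],
    complexRow 4 5 [[1, 6], [2, 7], [3, 8], [4, 9]]
      [[5], [1, 6], [2, 7], [3, 8], [4, 9]] [4, 2, 2, 2, 2],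
    complexRow 6 3 [[1], [4, 7], [5, 8], [6, 9]]
      [[1], [2, 3], [4, 7], [5, 8], [6, 9]] [2, 4, 2, 2, 2],
    complexRow 8 1 [[1], [8, 9], [2, 3, 4, 5], [4, 5, 6, 7]]
      [[1], [2, 3], [4, 5], [6, 7], [8, 9]] [2, 4, 4, 4, 2] ]

/-- Tabulated idempotents and stabilizers for `Cl_{p,q} ≅ Mat(2^k, ℍ)`. -/
def quaternionicTable : List TableRow :=
  [ quaternionicRow 0 4 [[1, 2, 3]]
      [[1], [2], [3]] [4, 4, 4] (.f3 0),
    quaternionicRow 1 3 [[1, 4]]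
      [[2], [3], [1, 4]] [4, 4, 2] (.f2 1),
    quaternionicRow 4 0 [[1]]
      [[1], [2, 3], [2, 4]] [2, 4, 4] (.f2 1),
    quaternionicRow 1 5 [[1, 6], [2, 3, 4]]
      [[2], [3], [4], [1, 6]] [4, 4, 4, 2] (.f3 1),
    quaternionicRow 2 4 [[1, 5], [2, 6]]
      [[3], [4], [1, 5], [2, 6]] [4, 4, 2, 2] (.f2 2),
    quaternionicRow 5 1 [[1], [5, 6]]
      [[1], [2, 3], [2, 4], [5, 6]] [2, 4, 4, 2] (.f2 2),
    quaternionicRow 6 0 [[1], [2, 3, 4, 5]]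
      [[1], [2, 3], [2, 4], [2, 5]] [2, 4, 4, 4] (.f3 1),
    quaternionicRow 2 6 [[1, 7], [2, 8], [3, 4, 5]]
      [[3], [4], [5], [1, 7], [2, 8]] [4, 4, 4, 2, 2] (.f3 2),
    quaternionicRow 3 5 [[1, 6], [2, 7], [3, 8]]
      [[4], [5], [1, 6], [2, 7], [3, 8]] [4, 4, 2, 2, 2] (.f2 3),
    quaternionicRow 6 2 [[1], [5, 7], [6, 8]]
      [[1], [2, 3], [3, 4], [5, 7], [6, 8]] [2, 4, 4, 2, 2] (.f2 3),
    quaternionicRow 7 1 [[1], [7, 8], [2, 3, 4, 5]]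
      [[1], [2, 3], [2, 4], [2, 5], [7, 8]] [2, 4, 4, 4, 2] (.f3 2) ]

end VeeStab

end

noncomputable section

namespace VeeStab

/-! ### The Clifford algebra -/

/-! The vee group `G` of order `2^(n+1)`, `n = p + q`, has the central involution `z = -1`, and all
its squares and commutators lie in `{1, z}` (`VeeLike`). The sign of a commutator is a bilinear
pairing on `G`, and the sign of a square is a quadratic refinement of it. The whole problem is
translated into these two signs.

Let `H` be the group generated by the monomials of `f`, and `C` its centralizer. Since `e_{I_j} f =
± f`, an element that anticommutes with some `e_{I_j}` cannot fix a nonzero `f`; hence the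
stabilizer is `C` (`stab_eq_centralizer`). The assumption `p - q ≢ 1 (mod 4)` says that `±1` are the
only central elements with square `1`, so orthogonality of characters gives `|±H| |C| = 2 |G|`
(`card_mul_card_centralizer`).

It remains to show `-1 ∉ H` and to find the squares of the elements of `C`. If some `v ∈ C` outside
`±H` had square `1`, then `f` would split as `f(1+v)/2 + f(1-v)/2`; both summands are nonzero
because some `g ∈ C` anticommutes with `v`. So primitivity forces `v² = -1`
(`mul_self_of_isPrimitiveIdempotent`). Now sum the signs of all squares in `G`. Elements outside `C`
cancel, so the sum is at least `2|±H| - |C|`, with equality exactly when all of `C` outside `±H`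
squares to `-1` (`sum_sqSign_eq_iff`). On the other hand the sum is the real part of a product of
Gaussian integers, which the Radon–Hurwitz value of `k` turns into `2·2^(k+1) - 2^(n+1-k)`.
Comparing the two excludes `-1 ∈ H` and gives `|C| = 2^(n+1-k)`.

The index of `±H` in `C` is therefore `2^(n-2k)`, that is `1`, `2` or `4`. In the three cases `C` is
`±H`, or `H × ⟨w⟩` with `w² = -1`, or `H` times a quaternion group, which is `F_2`.

For the tables the argument runs backwards: independence of the listed monomials gives `-1 ∉ H`,
hence the orders, and equality of the sums then gives the squares, so primitivity of the listed
idempotents is not needed. The remaining conditions are parities of list lengths, which are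
decidable. -/

/-- The product of the generators `e_i` along a list. -/
def listProd (p q : ℕ) (l : List (Fin (p + q))) : Cl p q := (l.map (e p q)).prod

theorem listProd_cons (p q : ℕ) (a : Fin (p + q)) (l : List (Fin (p + q))) :
    listProd p q (a :: l) = e p q a * listProd p q l := by
  simp [listProd]

theorem negOne_pow_comm {A : Type*} [Ring A] (m : ℕ) (x : A) : (-1) ^ m * x = x * (-1) ^ m :=
  ((Commute.neg_one_left x).pow_left m).eq

/-- Each factor different from `e_a` contributes one sign and each factor equal to `e_a` none;
modulo 2 this is length plus multiplicity. -/
theorem e_mul_listProd (p q : ℕ) (a : Fin (p + q)) (l : List (Fin (p + q))) :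
    e p q a * listProd p q l = (-1) ^ (l.length + l.count a) * (listProd p q l * e p q a) := by
  induction l with
  | nil => simp [listProd]
  | cons b l ih =>
    simp only [listProd_cons, List.length_cons, List.count_cons]
    by_cases h : b = a
    · subst h
      rw [mul_assoc, ih]
      simp only [beq_self_eq_true, if_true]
      rw [← mul_assoc (e p q b), ← negOne_pow_comm,
        show l.length + 1 + (l.count b + 1) = l.length + l.count b + 2 by ring, pow_add _ _ 2]
      simp [mul_assoc]
    · have hb : (b == a) = false := by simpa using h
      rw [← mul_assoc, e_mul_e p q (Ne.symm h), neg_mul, mul_assoc, ih]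
      simp only [hb]
      rw [← mul_assoc (e p q b), ← negOne_pow_comm,
        show l.length + 1 + (l.count a + (if false = true then 1 else 0))
          = l.length + l.count a + 1 by simp; ring, pow_add _ _ 1]
      simp [mul_assoc]

theorem listProd_mul_listProd (p q : ℕ) (l l' : List (Fin (p + q))) :
    listProd p q l * listProd p q l' =
      (-1) ^ (l.length * l'.length + (l.map fun a => l'.count a).sum) *
        (listProd p q l' * listProd p q l) := by
  induction l with
  | nil => simp [listProd]
  | cons a l ih =>
    simp only [listProd_cons, List.length_cons, List.map_cons, List.sum_cons]
    rw [mul_assoc, ih, ← mul_assoc (e p q a), ← negOne_pow_comm, mul_assoc ((-1) ^ _),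
      ← mul_assoc (e p q a), e_mul_listProd,
      show (l.length + 1) * l'.length + (l'.count a + (l.map fun a => l'.count a).sum) =
        (l.length * l'.length + (l.map fun a => l'.count a).sum) + (l'.length + l'.count a) by ring,
      pow_add _ _ (l'.length + l'.count a)]
    simp only [mul_assoc]

theorem e_mul_self_eq (p q : ℕ) (i : Fin (p + q)) :
    e p q i * e p q i = (-1) ^ (if p ≤ (i : ℕ) then 1 else 0) := by
  have h : form p q (Pi.single i 1) = if (i : ℕ) < p then (1 : ℝ) else -1 := by
    rw [QuadraticMap.weightedSumSquares_apply, Finset.sum_eq_single i]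
    · simp
    · intro j _ hj
      simp [Pi.single_eq_of_ne hj]
    · simp
  unfold e
  rw [CliffordAlgebra.ι_sq_scalar, h]
  by_cases hi : (i : ℕ) < p
  · simp [hi, not_le.mpr hi]
  · simp [hi, not_lt.mp hi]

/-- Moving the head through a tail not containing it costs one sign per factor; these costs add up
to the binomial coefficient, and the generators with square `-1` give the rest. -/
theorem listProd_mul_self (p q : ℕ) (l : List (Fin (p + q))) (hl : l.Nodup) :
    listProd p q l * listProd p q l =
      (-1) ^ (l.length.choose 2 + l.countP (fun i : Fin (p + q) => p ≤ (i : ℕ))) := by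
  induction l with
  | nil => simp [listProd]
  | cons a l ih =>
    rw [List.nodup_cons] at hl
    simp only [listProd_cons, List.length_cons, List.countP_cons]
    have h1 : listProd p q l * e p q a = (-1) ^ l.length * (e p q a * listProd p q l) := by
      rw [e_mul_listProd, List.count_eq_zero_of_not_mem hl.1, add_zero, ← mul_assoc, ← pow_add,
        Even.neg_one_pow ⟨_, rfl⟩, one_mul]
    rw [mul_assoc, ← mul_assoc (listProd p q l), h1]
    rw [mul_assoc ((-1) ^ _), mul_assoc (e p q a), ih hl.2, ← negOne_pow_comm (_ + _),
      ← mul_assoc, ← negOne_pow_comm l.length, mul_assoc, ← mul_assoc (e p q a),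
      ← negOne_pow_comm (_ + _), mul_assoc, e_mul_self_eq, Nat.choose_succ_succ',
      Nat.choose_one_right]
    simp only [decide_eq_true_eq, ← pow_add]
    congr 1
    ring

theorem monomial_eq_listProd (p q : ℕ) (I : Finset (Fin (p + q))) :
    monomial p q I = listProd p q ((List.finRange (p + q)).filter (· ∈ I)) := by
  unfold monomial listProd
  induction List.finRange (p + q) with
  | nil => simp
  | cons a l ih =>
    by_cases h : a ∈ I <;> simp [h, ih]

theorem nodup_finRange_filter {n : ℕ} (I : Finset (Fin n)) :
    ((List.finRange n).filter (· ∈ I)).Nodup := (List.nodup_finRange _).filter _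

theorem toFinset_finRange_filter {n : ℕ} (I : Finset (Fin n)) :
    ((List.finRange n).filter (· ∈ I)).toFinset = I := by
  ext; simp

theorem length_finRange_filter {n : ℕ} (I : Finset (Fin n)) :
    ((List.finRange n).filter (· ∈ I)).length = I.card := by
  rw [← List.toFinset_card_of_nodup (nodup_finRange_filter I), toFinset_finRange_filter]

/-- The exponent of the sign in `e_I² = ±1`. -/
def sqExp (p : ℕ) {n : ℕ} (I : Finset (Fin n)) : ℕ :=
  I.card.choose 2 + (I.filter fun i : Fin n => p ≤ (i : ℕ)).card

theorem monomial_mul_self_eq (p q : ℕ) (I : Finset (Fin (p + q))) :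
    monomial p q I * monomial p q I = (-1) ^ sqExp p I := by
  rw [monomial_eq_listProd, listProd_mul_self _ _ _ (nodup_finRange_filter I),
    length_finRange_filter, List.countP_eq_length_filter,
    ← List.toFinset_card_of_nodup ((nodup_finRange_filter I).filter _), List.toFinset_filter,
    toFinset_finRange_filter]
  simp [sqExp]

theorem sum_count_eq_card_inter {α : Type*} [DecidableEq α] (l l' : List α) (hl : l.Nodup)
    (hl' : l'.Nodup) :
    (l.map fun a => l'.count a).sum = (l.toFinset ∩ l'.toFinset).card := by
  rw [← List.sum_toFinset _ hl, ← Finset.filter_mem_eq_inter, Finset.card_filter]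
  refine Finset.sum_congr rfl fun a _ => ?_
  rw [List.Nodup.count hl']
  simp

theorem monomial_mul_comm_eq (p q : ℕ) (I J : Finset (Fin (p + q))) :
    monomial p q I * monomial p q J =
      (-1) ^ (I.card * J.card + (I ∩ J).card) * (monomial p q J * monomial p q I) := by
  rw [monomial_eq_listProd p q I, monomial_eq_listProd p q J, listProd_mul_listProd,
    sum_count_eq_card_inter _ _ (nodup_finRange_filter I) (nodup_finRange_filter J),
    toFinset_finRange_filter, toFinset_finRange_filter, length_finRange_filter,
    length_finRange_filter]

/-! ### Sign-change automorphisms and distinctness of the monomials -/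

/-- The automorphism of `Cl_{p,q}` with `e_i ↦ -e_i` and `e_j ↦ e_j` for `j ≠ i`. -/
def flip (p q : ℕ) (i : Fin (p + q)) : Cl p q →ₐ[ℝ] Cl p q :=
  CliffordAlgebra.lift (form p q)
    ⟨(CliffordAlgebra.ι (form p q)).comp
      (LinearMap.mulLeft ℝ (fun j : Fin (p + q) => if j = i then (-1 : ℝ) else 1)), by
      intro v
      rw [LinearMap.comp_apply, CliffordAlgebra.ι_sq_scalar]
      congr 1
      simp only [QuadraticMap.weightedSumSquares_apply, LinearMap.mulLeft_apply, Pi.mul_apply]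
      refine Finset.sum_congr rfl fun j _ => ?_
      split_ifs <;> simp⟩

theorem flip_e (p q : ℕ) (i j : Fin (p + q)) :
    flip p q i (e p q j) = if j = i then -e p q j else e p q j := by
  unfold flip e
  rw [CliffordAlgebra.lift_ι_apply, LinearMap.comp_apply, LinearMap.mulLeft_apply,
    ← map_neg, ← apply_ite (CliffordAlgebra.ι (form p q))]
  congr 1
  ext l
  by_cases hl : l = j
  · subst hl; by_cases h : l = i <;> simp [h]
  · have h0 : (Pi.single j (1 : ℝ) : Fin (p + q) → ℝ) l = 0 := Pi.single_eq_of_ne hl 1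
    rw [Pi.mul_apply, h0, mul_zero]
    by_cases h : j = i
    · rw [if_pos h, Pi.neg_apply, h0, neg_zero]
    · rw [if_neg h, h0]

theorem flip_listProd (p q : ℕ) (i : Fin (p + q)) (l : List (Fin (p + q))) :
    flip p q i (listProd p q l) = (-1) ^ l.count i * listProd p q l := by
  induction l with
  | nil => simp [listProd]
  | cons a l ih =>
    rw [listProd_cons, map_mul, ih, flip_e, List.count_cons]
    by_cases h : a = i
    · subst h
      rw [← mul_assoc, ← negOne_pow_comm]
      simp [pow_add, mul_assoc]
    · rw [← mul_assoc, if_neg h, ← negOne_pow_comm]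
      simp [h, mul_assoc]

theorem flip_monomial (p q : ℕ) (i : Fin (p + q)) (I : Finset (Fin (p + q))) :
    flip p q i (monomial p q I) = if i ∈ I then -monomial p q I else monomial p q I := by
  rw [monomial_eq_listProd, flip_listProd, List.Nodup.count (nodup_finRange_filter I)]
  by_cases h : i ∈ I <;> simp [h]

theorem eq_zero_of_eq_neg {p q : ℕ} {x : Cl p q} (h : x = -x) : x = 0 := by
  have h2 : (2 : ℝ) • x = 0 := by
    rw [two_smul]; nth_rewrite 1 [h]; simp
  simpa using h2

/-- An index `i` in `I` but not in `J` would make `flip p q i` negate `e_I` and fix `± e_J`, so that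
the unit `e_I` would equal its own negative. -/
theorem mem_of_signEq_monomial {p q : ℕ} {I J : Finset (Fin (p + q))}
    (h : SignEq (monomial p q I) (monomial p q J)) {i : Fin (p + q)} (hi : i ∈ I) : i ∈ J := by
  by_contra hj
  have h1 : flip p q i (monomial p q I) = monomial p q I := by
    rcases h with h | h <;> rw [h] <;> simp [flip_monomial, hj]
  rw [flip_monomial, if_pos hi] at h1
  exact (isUnit_monomial p q I).ne_zero (eq_zero_of_eq_neg h1.symm)

theorem eq_of_signEq_monomial {p q : ℕ} {I J : Finset (Fin (p + q))}
    (h : SignEq (monomial p q I) (monomial p q J)) : I = J := by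
  have h' : SignEq (monomial p q J) (monomial p q I) := by
    rcases h with h | h <;> simp [SignEq, h]
  exact Finset.Subset.antisymm (fun _ => mem_of_signEq_monomial h) fun _ => mem_of_signEq_monomial h'

/-! ### The vee group -/

theorem veeGroup_ext {p q : ℕ} {g h : veeGroup p q}
    (H : ((g : (Cl p q)ˣ) : Cl p q) = ((h : (Cl p q)ˣ) : Cl p q)) : g = h :=
  Subtype.ext (Units.ext H)

@[simp]
theorem coe_veeMonomial (p q : ℕ) (I : Finset (Fin (p + q))) :
    ((veeMonomial p q I : (Cl p q)ˣ) : Cl p q) = monomial p q I := rfl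

@[simp]
theorem coe_veeNegOne (p q : ℕ) : ((veeNegOne p q : (Cl p q)ˣ) : Cl p q) = -1 := rfl

theorem veeNegOne_ne_one (p q : ℕ) : veeNegOne p q ≠ 1 := by
  intro h
  have h1 : (1 : Cl p q) = -1 := by
    rw [← coe_veeNegOne, h]; simp
  exact one_ne_zero (eq_zero_of_eq_neg h1)

theorem veeNegOne_mul_self (p q : ℕ) : veeNegOne p q * veeNegOne p q = 1 :=
  veeGroup_ext (by simp)

theorem veeMonomial_or (p q : ℕ) (g : veeGroup p q) :
    ∃ I, g = veeMonomial p q I ∨ g = veeNegOne p q * veeMonomial p q I := by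
  obtain ⟨u, I, hI⟩ := g
  refine ⟨I, hI.imp (fun h => veeGroup_ext (by simpa using h)) fun h => veeGroup_ext (by simpa using h)⟩

theorem veeMonomial_mul_self (p q : ℕ) (I : Finset (Fin (p + q))) :
    veeMonomial p q I * veeMonomial p q I = veeNegOne p q ^ sqExp p I :=
  veeGroup_ext (by simpa using monomial_mul_self_eq p q I)

theorem veeMonomial_mul_comm (p q : ℕ) (I J : Finset (Fin (p + q))) :
    veeMonomial p q I * veeMonomial p q J =
      veeNegOne p q ^ (I.card * J.card + (I ∩ J).card) *
        (veeMonomial p q J * veeMonomial p q I) :=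
  veeGroup_ext (by simpa using monomial_mul_comm_eq p q I J)

theorem veeNegOne_pow_eq_one_iff (p q m : ℕ) : veeNegOne p q ^ m = 1 ↔ m % 2 = 0 := by
  constructor
  · intro h
    by_contra hm
    have : m = 2 * (m / 2) + 1 := by omega
    rw [this, pow_succ, pow_mul, sq, veeNegOne_mul_self, one_pow, one_mul] at h
    exact veeNegOne_ne_one p q h
  · intro h
    have : m = 2 * (m / 2) := by omega
    rw [this, pow_mul, sq, veeNegOne_mul_self, one_pow]

/-- `(s, I) ↦ (-1)^s e_I`. -/
def veeOf (p q : ℕ) (x : Bool × Finset (Fin (p + q))) : veeGroup p q :=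
  veeNegOne p q ^ (if x.1 then 1 else 0) * veeMonomial p q x.2

theorem veeOf_bijective (p q : ℕ) : Function.Bijective (veeOf p q) := by
  constructor
  · rintro ⟨s, I⟩ ⟨t, J⟩ h
    have h0 : I = J := by
      apply eq_of_signEq_monomial
      have h1 := congrArg (fun g : veeGroup p q => ((g : (Cl p q)ˣ) : Cl p q)) h
      cases s <;> cases t <;> simp [veeOf, neg_eq_iff_eq_neg] at h1 <;> simp [SignEq, h1]
    subst h0
    have h1 := mul_right_cancel h
    have h2 := veeNegOne_ne_one p q
    cases s <;> cases t <;> simp at h1 ⊢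
    · exact h2 h1.symm
    · exact h2 h1
  · intro g
    obtain ⟨I, h | h⟩ := veeMonomial_or p q g
    · exact ⟨(false, I), by simp [veeOf, h]⟩
    · exact ⟨(true, I), by simp [veeOf, h]⟩

instance (p q : ℕ) : Finite (veeGroup p q) :=
  Finite.of_surjective _ (veeOf_bijective p q).2

theorem card_veeGroup (p q : ℕ) : Nat.card (veeGroup p q) = 2 ^ (p + q + 1) := by
  rw [← Nat.card_eq_of_bijective _ (veeOf_bijective p q)]
  simp [pow_succ, mul_comm]

/-- The sign by which the automorphism `flip p q i` acts on an element of the vee group. -/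
theorem exists_veeSign (p q : ℕ) (i : Fin (p + q)) :
    ∃ φ : veeGroup p q →* ℤˣ, φ (veeNegOne p q) = 1 ∧
      ∀ I, φ (veeMonomial p q I) = if i ∈ I then -1 else 1 := by
  classical
  have key : ∀ g : veeGroup p q, ∃ s : ℤˣ,
      flip p q i ((g : (Cl p q)ˣ) : Cl p q) = ((s : ℤˣ) : ℤ) • ((g : (Cl p q)ˣ) : Cl p q) := by
    intro g
    obtain ⟨I, h | h⟩ := veeMonomial_or p q g <;> subst h <;> by_cases hi : i ∈ I
    · exact ⟨-1, by simp [flip_monomial, hi]⟩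
    · exact ⟨1, by simp [flip_monomial, hi]⟩
    · exact ⟨-1, by simp [flip_monomial, hi]⟩
    · exact ⟨1, by simp [flip_monomial, hi]⟩
  -- A unit is not its own negative, so the sign is determined by `g`; multiplicativity of the
  -- chosen signs follows from this uniqueness.
  have uniq : ∀ (g : veeGroup p q) (s t : ℤˣ),
      ((s : ℤˣ) : ℤ) • ((g : (Cl p q)ˣ) : Cl p q) = ((t : ℤˣ) : ℤ) • ((g : (Cl p q)ˣ) : Cl p q) →
        s = t := by
    intro g s t h
    have hg : ((g : (Cl p q)ˣ) : Cl p q) ≠ 0 := (g : (Cl p q)ˣ).ne_zero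
    rcases Int.units_eq_one_or s with rfl | rfl <;> rcases Int.units_eq_one_or t with rfl | rfl <;>
      simp at h ⊢
    · exact hg (eq_zero_of_eq_neg h)
    · exact hg (eq_zero_of_eq_neg h.symm)
  choose s hs using key
  refine ⟨MonoidHom.mk' s fun a b => uniq (a * b) _ _ ?_, ?_, fun I => ?_⟩
  · rw [← hs]
    simp only [Subgroup.coe_mul, Units.val_mul, map_mul, hs, Units.val_mul, smul_mul_smul_comm]
  · refine uniq (veeNegOne p q) _ _ ?_
    rw [MonoidHom.mk'_apply, ← hs]
    simp
  · refine uniq (veeMonomial p q I) _ _ ?_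
    rw [MonoidHom.mk'_apply, ← hs]
    by_cases h : i ∈ I <;> simp [flip_monomial, h]

/-! ### Finite groups with a distinguished central involution containing all squares -/

/-- `z` is a central element of order `2` and all squares and commutators lie in `{1, z}`. -/
structure VeeLike {G : Type*} [Group G] (z : G) : Prop where
  ne_one : z ≠ 1
  mul_self : z * z = 1
  central : ∀ g, g * z = z * g
  sq : ∀ g, g * g = 1 ∨ g * g = z
  comm : ∀ g h, g * h = h * g ∨ g * h = z * (h * g)

/-! ### The commutator pairing and the signs of squares -/

open Classical in
/-- The sign of a commutator. -/
def comSign {G : Type*} [Group G] (g h : G) : ℤ := if g * h = h * g then 1 else -1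

open Classical in
/-- The sign of a square. -/
def sqSign {G : Type*} [Group G] (g : G) : ℤ := if g * g = 1 then 1 else -1

theorem comSign_comm {G : Type*} [Group G] (g h : G) : comSign g h = comSign h g := by
  classical
  unfold comSign
  exact if_congr eq_comm rfl rfl

theorem comSign_eq_one {G : Type*} [Group G] {g h : G} : comSign g h = 1 ↔ g * h = h * g := by
  unfold comSign
  split_ifs with hh <;> simp [hh]

theorem sqSign_eq_one {G : Type*} [Group G] {g : G} : sqSign g = 1 ↔ g * g = 1 := by
  unfold sqSign
  split_ifs with hh <;> simp [hh]

theorem sqSign_congr {G : Type*} [Group G] {g h : G} (H : g * g = 1 ↔ h * h = 1) :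
    sqSign g = sqSign h := by
  unfold sqSign
  split_ifs <;> simp_all

namespace VeeLike

variable {G : Type*} [Group G] {z : G}

theorem z_mul_cancel (hz : VeeLike z) (g : G) : z * (z * g) = g := by
  rw [← mul_assoc, hz.mul_self, one_mul]

theorem z_mul_ne (hz : VeeLike z) (g : G) : z * g ≠ g := fun h => hz.ne_one (by simpa using h)

/-- A conjugate of `x` is `x` or `z x`. -/
theorem normal_of_mem (hz : VeeLike z) {H : Subgroup G} (h : z ∈ H) : H.Normal := by
  refine ⟨fun x hx g => ?_⟩
  rcases hz.comm g x with h1 | h1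
  · rwa [h1, mul_inv_cancel_right]
  · rw [h1, ← mul_assoc, mul_inv_cancel_right]
    exact H.mul_mem h hx

theorem comSign_eq_neg_one (hz : VeeLike z) {g h : G} :
    comSign g h = -1 ↔ g * h = z * (h * g) := by
  unfold comSign
  split_ifs with hh
  · rw [hh]
    simpa using (hz.z_mul_ne (h * g)).symm
  · simpa using (hz.comm g h).resolve_left hh

theorem sqSign_eq_neg_one (hz : VeeLike z) {g : G} : sqSign g = -1 ↔ g * g = z := by
  unfold sqSign
  split_ifs with hh
  · rw [hh]
    simpa using hz.ne_one.symm
  · simpa using (hz.sq g).resolve_left hh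

/-- Commutators are central, so `comSign g` is a character of `G`; this makes the orthogonality
arguments below available. -/
theorem comSign_mul_right (hz : VeeLike z) (g h h' : G) :
    comSign g (h * h') = comSign g h * comSign g h' := by
  rcases hz.comm g h with h1 | h1 <;> rcases hz.comm g h' with h2 | h2
  · rw [comSign_eq_one.2 h1, comSign_eq_one.2 h2, one_mul, comSign_eq_one, ← mul_assoc, h1,
      mul_assoc, h2, mul_assoc]
  · rw [comSign_eq_one.2 h1, hz.comSign_eq_neg_one.2 h2, one_mul, hz.comSign_eq_neg_one,
      ← mul_assoc, h1, mul_assoc, h2, ← mul_assoc, hz.central]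
    simp only [mul_assoc]
  · rw [hz.comSign_eq_neg_one.2 h1, comSign_eq_one.2 h2, mul_one, hz.comSign_eq_neg_one,
      ← mul_assoc, h1]
    simp only [mul_assoc, h2]
  · rw [hz.comSign_eq_neg_one.2 h1, hz.comSign_eq_neg_one.2 h2, neg_mul_neg, one_mul,
      comSign_eq_one, ← mul_assoc, h1, mul_assoc, mul_assoc, h2, ← mul_assoc h, hz.central,
      mul_assoc, hz.z_mul_cancel, mul_assoc]

/-- The square of `gh` differs from `g² h²` by the commutator: the square sign is a quadratic form
whose polarization is the commutator pairing. -/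
theorem sqSign_mul (hz : VeeLike z) (g h : G) :
    sqSign (g * h) = sqSign g * sqSign h * comSign g h := by
  have key : g * h * (g * h) = g * (h * g) * h := by simp only [mul_assoc]
  have key2 : g * (g * h) * h = (g * g) * (h * h) := by simp only [mul_assoc]
  have key3 : g * h = z * (h * g) → h * g = z * (g * h) := fun h1 => by
    rw [h1, hz.z_mul_cancel]
  have key4 : ∀ x : G, g * (z * x) * h = z * (g * x * h) := fun x => by
    rw [← mul_assoc g, hz.central]
    simp only [mul_assoc]
  rcases hz.comm g h with h1 | h1 <;> rcases hz.sq g with h2 | h2 <;> rcases hz.sq h with h3 | h3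
  · rw [comSign_eq_one.2 h1, sqSign_eq_one.2 h2, sqSign_eq_one.2 h3, one_mul, one_mul,
      sqSign_eq_one, key, ← h1, key2, h2, h3, one_mul]
  · rw [comSign_eq_one.2 h1, sqSign_eq_one.2 h2, hz.sqSign_eq_neg_one.2 h3, one_mul, mul_one,
      hz.sqSign_eq_neg_one, key, ← h1, key2, h2, h3, one_mul]
  · rw [comSign_eq_one.2 h1, hz.sqSign_eq_neg_one.2 h2, sqSign_eq_one.2 h3, mul_one, mul_one,
      hz.sqSign_eq_neg_one, key, ← h1, key2, h2, h3, mul_one]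
  · rw [comSign_eq_one.2 h1, hz.sqSign_eq_neg_one.2 h2, hz.sqSign_eq_neg_one.2 h3, mul_one,
      neg_mul_neg, one_mul, sqSign_eq_one, key, ← h1, key2, h2, h3, hz.mul_self]
  · rw [hz.comSign_eq_neg_one.2 h1, sqSign_eq_one.2 h2, sqSign_eq_one.2 h3, one_mul, one_mul,
      hz.sqSign_eq_neg_one, key, key3 h1, key4, key2, h2, h3, one_mul, mul_one]
  · rw [hz.comSign_eq_neg_one.2 h1, sqSign_eq_one.2 h2, hz.sqSign_eq_neg_one.2 h3, one_mul,
      neg_mul_neg, one_mul, sqSign_eq_one, key, key3 h1, key4, key2, h2, h3, one_mul, hz.mul_self]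
  · rw [hz.comSign_eq_neg_one.2 h1, hz.sqSign_eq_neg_one.2 h2, sqSign_eq_one.2 h3, mul_one,
      neg_mul_neg, one_mul, sqSign_eq_one, key, key3 h1, key4, key2, h2, h3, mul_one, hz.mul_self]
  · rw [hz.comSign_eq_neg_one.2 h1, hz.sqSign_eq_neg_one.2 h2, hz.sqSign_eq_neg_one.2 h3,
      neg_mul_neg, one_mul, one_mul, hz.sqSign_eq_neg_one, key, key3 h1, key4, key2, h2, h3,
      hz.mul_self, mul_one]

/-- The character `comSign g` is nontrivial on `N`; translating by some `h0` where it is `-1`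
negates the sum. -/
theorem sum_comSign_eq_zero [Fintype G] (hz : VeeLike z) (N : Subgroup G) [Fintype N] {g : G}
    (hg : g ∉ Subgroup.centralizer (N : Set G)) : ∑ h : N, comSign g (h : G) = 0 := by
  rw [Subgroup.mem_centralizer_iff] at hg
  push Not at hg
  obtain ⟨h0, h0N, h0g⟩ := hg
  have h1 : comSign g h0 = -1 := hz.comSign_eq_neg_one.2
    ((hz.comm g h0).resolve_left fun h => h0g h.symm)
  have h2 : ∑ h : N, comSign g (h : G) = ∑ h : N, -comSign g (h : G) :=
    (Fintype.sum_equiv (Equiv.mulLeft (⟨h0, h0N⟩ : N)) _ _ fun h => by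
      simp [hz.comSign_mul_right, h1])
  rw [Finset.sum_neg_distrib] at h2
  omega

open Classical in
theorem sum_comSign [Fintype G] (hz : VeeLike z) (N : Subgroup G) [Fintype N] (g : G) :
    ∑ h : N, comSign g (h : G) =
      if g ∈ Subgroup.centralizer (N : Set G) then (Nat.card N : ℤ) else 0 := by
  split_ifs with hg
  · rw [Finset.sum_congr rfl fun (h : N) _ => comSign_eq_one.2
      ((Subgroup.mem_centralizer_iff.1 hg h h.2).symm)]
    simp
  · exact hz.sum_comSign_eq_zero N hg

open Classical in
theorem sum_ite_mem [Fintype G] (N : Subgroup G) [Fintype N] (f : G → ℤ) :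
    ∑ g : G, (if g ∈ N then f g else 0) = ∑ g : N, f g := by
  rw [← Finset.sum_filter]
  exact (Finset.sum_subtype _ (by simp) f)

/-- A subgroup meeting the center in `{1, z}` and its centralizer have complementary orders. -/
theorem card_mul_card_centralizer [Finite G] (hz : VeeLike z) (N : Subgroup G) (hN : z ∈ N)
    (hc : ∀ h ∈ N, (∀ g, g * h = h * g) → h = 1 ∨ h = z) :
    Nat.card N * Nat.card (Subgroup.centralizer (N : Set G)) = 2 * Nat.card G := by
  classical
  let _ := Fintype.ofFinite G
  -- Double counting of the pairing over `G × N`: summing over `N` first leaves the centralizer,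
  -- summing over `G` first leaves only the central elements `1` and `z` of `N`.
  have h1 : ∑ g : G, ∑ h : N, comSign g (h : G) =
      (Nat.card (Subgroup.centralizer (N : Set G)) : ℤ) * Nat.card N := by
    rw [Finset.sum_congr rfl fun g _ => hz.sum_comSign N g,
      sum_ite_mem (Subgroup.centralizer (N : Set G)) fun _ => (Nat.card N : ℤ)]
    simp
  have h2 : ∀ h : N, ∑ g : G, comSign g (h : G) =
      if h = 1 ∨ h = ⟨z, hN⟩ then (Nat.card G : ℤ) else 0 := by
    intro h
    have h3 := hz.sum_comSign (⊤ : Subgroup G) (h : G)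
    have h4 : ∑ g : (⊤ : Subgroup G), comSign (h : G) (g : G) = ∑ g : G, comSign g (h : G) :=
      Fintype.sum_equiv Subgroup.topEquiv.toEquiv _ _ fun g => comSign_comm _ _
    rw [← h4, h3, Subgroup.card_top]
    refine if_congr ?_ rfl rfl
    rw [Subgroup.mem_centralizer_iff]
    constructor
    · intro h5
      refine (hc h h.2 fun g => h5 g (by simp)).imp (fun h6 => Subtype.ext h6)
        fun h6 => Subtype.ext h6
    · rintro (rfl | rfl) g -
      · simp
      · exact hz.central g
  rw [Finset.sum_comm, Finset.sum_congr rfl fun h _ => h2 h, ← Finset.sum_filter,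
    Finset.sum_const, Finset.filter_or, Finset.filter_eq', Finset.filter_eq',
    if_pos (Finset.mem_univ _), if_pos (Finset.mem_univ _), Finset.card_union_of_disjoint] at h1
  · simp only [Finset.card_singleton, nsmul_eq_mul] at h1
    push_cast at h1
    zify
    linarith
  · rw [Finset.disjoint_singleton]
    intro h
    exact hz.ne_one (congrArg Subtype.val h).symm

/-- The signs of the squares of elements which do not centralize a subgroup of exponent `2`
cancel. -/
theorem sum_sqSign_eq_sum_centralizer [Fintype G] (hz : VeeLike z) (N : Subgroup G)
    [Fintype (Subgroup.centralizer (N : Set G))]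
    (hsq : ∀ h ∈ N, h * h = 1) :
    ∑ g : G, sqSign g = ∑ g : Subgroup.centralizer (N : Set G), sqSign (g : G) := by
  classical
  -- Since `h² = 1`, replacing `g` by `g h⁻¹` changes the square sign only by the commutator sign.
  -- Averaging over `h ∈ N` then kills every `g` outside the centralizer.
  have h1 : ∀ h : N, ∑ g : G, sqSign g = ∑ g : G, sqSign g * comSign g (h : G) := by
    intro h
    refine Fintype.sum_equiv (Equiv.mulRight (h : G)⁻¹) _ _ fun g => ?_
    have h2 := hz.sqSign_mul (g * (h : G)⁻¹) h
    rw [inv_mul_cancel_right, sqSign_eq_one.2 (hsq h h.2), mul_one] at h2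
    exact h2
  have h3 : (Nat.card N : ℤ) * ∑ g : G, sqSign g =
      Nat.card N * ∑ g : Subgroup.centralizer (N : Set G), sqSign (g : G) := by
    calc (Nat.card N : ℤ) * ∑ g : G, sqSign g = ∑ h : N, ∑ g : G, sqSign g := by simp
      _ = ∑ h : N, ∑ g : G, sqSign g * comSign g (h : G) := Finset.sum_congr rfl fun h _ => h1 h
      _ = ∑ g : G, sqSign g * ∑ h : N, comSign g (h : G) := by
        rw [Finset.sum_comm]
        simp only [Finset.mul_sum]
      _ = ∑ g : G, if g ∈ Subgroup.centralizer (N : Set G) then sqSign g * Nat.card N else 0 :=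
        Finset.sum_congr rfl fun g _ => by rw [hz.sum_comSign N g, mul_ite, mul_zero]
      _ = _ := by
        rw [sum_ite_mem (Subgroup.centralizer (N : Set G)) fun g => sqSign g * (Nat.card N : ℤ),
          ← Finset.sum_mul, mul_comm]
  exact mul_left_cancel₀ (by exact_mod_cast (Nat.card_pos (α := N)).ne') h3

theorem neg_one_le_sqSign (g : G) : -1 ≤ sqSign g := by
  unfold sqSign; split_ifs <;> simp

/-- The sum of the signs of all squares in terms of an elementary abelian subgroup `N`: it is at
least `2|N| - |C(N)|`, with equality if and only if all `g ∈ C(N) \ N` have square `z`. -/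
theorem sum_sqSign_eq_iff [Fintype G] (hz : VeeLike z) (N : Subgroup G)
    (hsq : ∀ h ∈ N, h * h = 1) (hcm : N ≤ Subgroup.centralizer (N : Set G)) :
    ∑ g : G, sqSign g = 2 * Nat.card N - Nat.card (Subgroup.centralizer (N : Set G)) ↔
      ∀ g ∈ Subgroup.centralizer (N : Set G), g ∉ N → g * g = z := by
  classical
  set C := Subgroup.centralizer (N : Set G)
  -- Every summand is nonnegative, being `0` on `N` and `sqSign g + 1` elsewhere. So the total
  -- vanishes exactly when each `g ∈ C` outside `N` has square sign `-1`.
  have h1 : ∑ g : C, (sqSign (g : G) + 1 - if (g : G) ∈ N then 2 else 0) =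
      ∑ g : G, sqSign g + Nat.card C - 2 * Nat.card N := by
    rw [Finset.sum_sub_distrib, Finset.sum_add_distrib, ← hz.sum_sqSign_eq_sum_centralizer N hsq,
      ← sum_ite_mem C fun g => if g ∈ N then 2 else 0]
    have : ∀ g : G, (if g ∈ C then (if g ∈ N then (2 : ℤ) else 0) else 0) =
        if g ∈ N then 2 else 0 := by
      intro g
      by_cases hg : g ∈ N
      · simp [hg, hcm hg]
      · simp [hg]
    rw [Finset.sum_congr rfl fun g _ => this g, sum_ite_mem N fun _ => (2 : ℤ)]
    simp [mul_comm]
  have h2 : ∀ g : C, 0 ≤ sqSign (g : G) + 1 - if (g : G) ∈ N then 2 else 0 := by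
    intro g
    split_ifs with hg
    · simp [sqSign_eq_one.2 (hsq g hg)]
    · have := neg_one_le_sqSign (g : G)
      omega
  have h3 := Finset.sum_eq_zero_iff_of_nonneg (s := Finset.univ) fun (g : C) _ => h2 g
  rw [h1] at h3
  constructor
  · intro h4 g hgC hgN
    have h5 := h3.1 (by omega) ⟨g, hgC⟩ (Finset.mem_univ _)
    simp only [hgN, if_false] at h5
    exact hz.sqSign_eq_neg_one.1 (by omega)
  · intro h4
    have h5 := h3.2 fun g _ => by
      by_cases hg : (g : G) ∈ N
      · simp [hg, sqSign_eq_one.2 (hsq g hg)]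
      · simp [hg, hz.sqSign_eq_neg_one.2 (h4 g g.2 hg)]
    omega

/-! ### Adjoining the central involution to a subgroup -/

/-- The subgroup generated by `H` and `z`. -/
def adjoin (hz : VeeLike z) (H : Subgroup G) : Subgroup G where
  carrier := {g | g ∈ H ∨ z * g ∈ H}
  one_mem' := Or.inl H.one_mem
  mul_mem' := by
    rintro a b (ha | ha) (hb | hb)
    · exact Or.inl (H.mul_mem ha hb)
    · right
      rw [← mul_assoc, ← hz.central, mul_assoc]
      exact H.mul_mem ha hb
    · right
      rw [← mul_assoc]
      exact H.mul_mem ha hb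
    · left
      have := H.mul_mem ha hb
      rwa [← hz.central, mul_assoc, hz.z_mul_cancel] at this
  inv_mem' := by
    rintro a (ha | ha)
    · exact Or.inl (H.inv_mem ha)
    · right
      have := H.inv_mem ha
      rwa [mul_inv_rev, inv_eq_of_mul_eq_one_right hz.mul_self, hz.central] at this

theorem mem_adjoin (hz : VeeLike z) {H : Subgroup G} {g : G} :
    g ∈ hz.adjoin H ↔ g ∈ H ∨ z * g ∈ H := Iff.rfl

theorem le_adjoin (hz : VeeLike z) (H : Subgroup G) : H ≤ hz.adjoin H := fun _ h => Or.inl h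

theorem z_mem_adjoin (hz : VeeLike z) (H : Subgroup G) : z ∈ hz.adjoin H :=
  Or.inr (by rw [hz.mul_self]; exact H.one_mem)

theorem adjoin_eq_self (hz : VeeLike z) {H : Subgroup G} (h : z ∈ H) : hz.adjoin H = H := by
  refine le_antisymm ?_ (hz.le_adjoin H)
  rintro g (hg | hg)
  · exact hg
  · simpa [hz.z_mul_cancel] using H.mul_mem h hg

theorem card_adjoin [Finite G] (hz : VeeLike z) {H : Subgroup G} (h : z ∉ H) :
    Nat.card (hz.adjoin H) = 2 * Nat.card H := by
  have hb : Function.Bijective (fun x : Bool × H => (⟨z ^ (if x.1 then 1 else 0) * x.2, by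
      rw [hz.mem_adjoin]
      cases x.1
      · simp
      · right
        simp [hz.z_mul_cancel]⟩ : hz.adjoin H)) := by
    constructor
    · rintro ⟨s, x, hx⟩ ⟨t, y, hy⟩ hxy
      simp only [Subtype.mk.injEq] at hxy
      cases s <;> cases t <;> simp at hxy
      · simp [hxy]
      · refine (h ?_).elim
        have : z = x * y⁻¹ := by simp [hxy]
        exact this ▸ H.mul_mem hx (H.inv_mem hy)
      · refine (h ?_).elim
        have : z = y * x⁻¹ := by simp [← hxy]
        exact this ▸ H.mul_mem hy (H.inv_mem hx)
      · simp [hxy]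
    · rintro ⟨g, hg | hg⟩
      · exact ⟨(false, ⟨g, hg⟩), by simp⟩
      · exact ⟨(true, ⟨_, hg⟩), by simp [hz.z_mul_cancel]⟩
  rw [← Nat.card_eq_of_bijective _ hb]
  simp

theorem centralizer_adjoin (hz : VeeLike z) (H : Subgroup G) :
    Subgroup.centralizer (hz.adjoin H : Set G) = Subgroup.centralizer (H : Set G) := by
  refine le_antisymm (Subgroup.centralizer_le (hz.le_adjoin H)) fun g hg => ?_
  rw [Subgroup.mem_centralizer_iff] at hg ⊢
  rintro h (hh | hh)
  · exact hg h hh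
  · have h1 := hg _ hh
    rw [← mul_assoc, hz.central, mul_assoc, mul_assoc] at h1
    exact mul_left_cancel h1

theorem sq_adjoin (hz : VeeLike z) {H : Subgroup G} (hsq : ∀ h ∈ H, h * h = 1) :
    ∀ h ∈ hz.adjoin H, h * h = 1 := by
  rintro h (hh | hh)
  · exact hsq h hh
  · have := hsq _ hh
    rwa [mul_assoc, ← mul_assoc h, hz.central, mul_assoc, hz.z_mul_cancel] at this

theorem adjoin_le_centralizer (hz : VeeLike z) {H : Subgroup G}
    (hcm : H ≤ Subgroup.centralizer (H : Set G)) :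
    hz.adjoin H ≤ Subgroup.centralizer (hz.adjoin H : Set G) := by
  rw [hz.centralizer_adjoin]
  rintro g (hg | hg)
  · exact hcm hg
  · have h1 := hcm hg
    rw [Subgroup.mem_centralizer_iff] at h1 ⊢
    intro h hh
    have h2 := h1 h hh
    rw [← mul_assoc, hz.central, mul_assoc, mul_assoc] at h2
    exact mul_left_cancel h2

end VeeLike

/-! ### Isomorphism types -/

/-- A group of exponent dividing `2` is a vector space over the field with two elements, determined
by its dimension. -/
theorem nonempty_mulEquiv_cyclicPower_two {H : Type*} [Group H] [Finite H] {k : ℕ}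
    (hsq : ∀ h : H, h * h = 1) (hcard : Nat.card H = 2 ^ k) :
    Nonempty (H ≃* CyclicPower 2 k) := by
  let _ : CommGroup H := { ‹Group H› with
    mul_comm := fun a b => by
      have h1 : ∀ h : H, h⁻¹ = h := fun h => inv_eq_of_mul_eq_one_right (hsq h)
      rw [← h1 (a * b), mul_inv_rev, h1, h1] }
  let _ : Module (ZMod 2) (Additive H) := AddCommGroup.zmodModule (n := 2) fun x => by
    rw [two_nsmul]; exact hsq x.toMul
  have h2 : Module.finrank (ZMod 2) (Additive H) = Module.finrank (ZMod 2) (Fin k → ZMod 2) := by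
    have h3 := Module.natCard_eq_pow_finrank (K := ZMod 2) (V := Additive H)
    have h4 : Nat.card (Additive H) = 2 ^ k := hcard
    rw [h4, Nat.card_zmod] at h3
    rw [Module.finrank_fin_fun]
    exact (Nat.pow_right_injective le_rfl h3).symm
  let φ : Additive H ≃ₗ[ZMod 2] (Fin k → ZMod 2) := LinearEquiv.ofFinrankEq _ _ h2
  exact ⟨{ toFun := fun h i => Multiplicative.ofAdd (φ (Additive.ofMul h) i)
           invFun := fun v => (φ.symm fun i => (v i).toAdd).toMul
           left_inv := fun h => by simp
           right_inv := fun v => by simp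
           map_mul' := fun a b => by ext i; simp }⟩

theorem nonempty_zpowers_mulEquiv {G : Type*} [Group G] {w : G} {m : ℕ} (hw : orderOf w = m) :
    Nonempty (Subgroup.zpowers w ≃* Multiplicative (ZMod m)) := by
  have h := zmodCyclicMulEquiv (G := Subgroup.zpowers w) inferInstance
  rw [Nat.card_zpowers, hw] at h
  exact ⟨h.symm⟩

/-- The multiplication map `H × K → C` is an injective homomorphism, and counting makes it
surjective. -/
theorem nonempty_prod_mulEquiv {G : Type*} [Group G] [Finite G] {H K C : Subgroup G} (hH : H ≤ C)
    (hK : K ≤ C) (hcomm : ∀ h ∈ H, ∀ k ∈ K, h * k = k * h) (hd : Disjoint H K)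
    (hcard : Nat.card C = Nat.card H * Nat.card K) : Nonempty (C ≃* H × K) := by
  let φ : H × K →* C := (Subgroup.inclusion hH).noncommCoprod (Subgroup.inclusion hK)
    fun h k => Subtype.ext (hcomm h h.2 k k.2)
  have hinj : Function.Injective φ := by
    rw [injective_iff_map_eq_one]
    rintro ⟨⟨h, hh⟩, ⟨k, hk⟩⟩ h1
    have h2 : h * k = 1 := congrArg Subtype.val h1
    have h3 : h = 1 := (Subgroup.disjoint_def.1 hd) hh
      (by rw [eq_inv_of_mul_eq_one_left h2]; exact K.inv_mem hk)
    subst h3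
    rw [one_mul] at h2
    subst h2
    rfl
  have hbij : Function.Bijective φ :=
    (Nat.bijective_iff_injective_and_card φ).2 ⟨hinj, by rw [Nat.card_prod, hcard]⟩
  exact ⟨(MulEquiv.ofBijective φ hbij).symm⟩

/-- Two anticommuting square roots of a central involution generate a quaternion group. -/
theorem exists_quaternionGroup_hom {G : Type*} [Group G] {z a b : G} (hz : VeeLike z)
    (ha : a * a = z) (hb : b * b = z) (hab : a * b = z * (b * a)) :
    ∃ φ : QuaternionGroup 2 →* G, Function.Injective φ ∧ φ.range = Subgroup.closure {a, b} ∧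
      φ (.a 1) = a ∧ φ (.xa 0) = b ∧ φ (.a 2) = z := by
  have ha4 : a ^ 4 = 1 := by
    rw [show (4 : ℕ) = 2 * 2 from rfl, pow_mul, pow_two a, ha, pow_two, hz.mul_self]
  -- The powers of `a` indexed by residues, which is legitimate because `a⁴ = 1`.
  let P : ZMod 4 → G := fun i => a ^ i.val
  have hP0 : P 0 = 1 := by simp [P]
  have hP1 : P 1 = a := by
    show a ^ (1 : ZMod 4).val = a
    rw [show (1 : ZMod 4).val = 1 from rfl, pow_one]
  have hP2 : P 2 = z := by
    show a ^ (2 : ZMod 4).val = z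
    rw [show (2 : ZMod 4).val = 2 from rfl, sq, ha]
  have hadd : ∀ i j, P (i + j) = P i * P j := fun i j => by
    show a ^ (i + j).val = a ^ i.val * a ^ j.val
    rw [ZMod.val_add, ← pow_add]
    conv_rhs => rw [← Nat.mod_add_div (i.val + j.val) 4, pow_add, pow_mul, ha4, one_pow, mul_one]
  have hneg : ∀ i, P (-i) = (P i)⁻¹ := fun i =>
    eq_inv_of_mul_eq_one_left (by rw [← hadd, neg_add_cancel, hP0])
  have hainv : a⁻¹ = z * a := inv_eq_of_mul_eq_one_right (by
    rw [← mul_assoc, hz.central, mul_assoc, ha, hz.mul_self])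
  have hconj : ∀ i, P i * b = b * P (-i) := fun i => by
    have h1 : SemiconjBy b a⁻¹ a := by
      show b * a⁻¹ = a * b
      rw [hainv, hab, ← mul_assoc, hz.central, mul_assoc]
    have h2 := h1.pow_right i.val
    rw [inv_pow] at h2
    rw [hneg]
    exact h2.eq.symm
  -- Powers of `a` commute with `a`, whereas `b` does not.
  have hbc : ∀ i, P i ≠ b := fun i h => by
    have h1 : a * P i = P i * a := by rw [← hP1, ← hadd, ← hadd, add_comm]
    rw [h] at h1
    rw [h1] at hab
    exact hz.z_mul_ne _ hab.symm
  -- Each nonzero residue modulo 4 is `2` or doubles to `2`, so a nontrivial relation would give `z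
  -- = 1`.
  have hPinj : ∀ i, P i = 1 → i = 0 := by
    intro i h
    have h1 : ∀ j : ZMod 4, j = 0 ∨ j + j = 2 ∨ j = 2 := by decide
    rcases h1 i with h2 | h2 | h2
    · exact h2
    · exact (hz.ne_one (by rw [← hP2, ← h2, hadd, h, one_mul])).elim
    · exact (hz.ne_one (by rw [← hP2, ← h2, h])).elim
  let φ : QuaternionGroup 2 →* G := MonoidHom.mk'
    (fun x => match x with
      | .a i => P i
      | .xa i => b * P i) (by
    rintro (i | i) (j | j)
    · exact hadd i j
    · rw [QuaternionGroup.a_mul_xa]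
      show b * P (j - i) = P i * (b * P j)
      rw [← mul_assoc, hconj, mul_assoc, ← hadd, neg_add_eq_sub]
    · rw [QuaternionGroup.xa_mul_a]
      show b * P (i + j) = b * P i * P j
      rw [hadd, mul_assoc]
    · rw [QuaternionGroup.xa_mul_xa]
      show P (2 + j - i) = b * P i * (b * P j)
      rw [mul_assoc, ← mul_assoc (P i), hconj, ← mul_assoc, ← mul_assoc, hb, ← hP2, mul_assoc,
        ← hadd, ← hadd]
      congr 1
      ring)
  have hφa : ∀ i, φ (.a i) = P i := fun _ => rfl
  have hφx : ∀ i, φ (.xa i) = b * P i := fun _ => rfl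
  refine ⟨φ, ?_, ?_, hP1, by rw [hφx, hP0, mul_one], hP2⟩
  · rw [injective_iff_map_eq_one]
    rintro (i | i) h
    · rw [hφa] at h
      rw [hPinj i h, QuaternionGroup.one_def]
    · rw [hφx] at h
      exact (hbc (-i) (by rw [hneg]; exact (eq_inv_of_mul_eq_one_left h).symm)).elim
  · refine le_antisymm ?_ ?_
    · rintro _ ⟨i | i, rfl⟩
      · exact Subgroup.pow_mem _ (Subgroup.subset_closure (by simp)) _
      · exact Subgroup.mul_mem _ (Subgroup.subset_closure (by simp))
          (Subgroup.pow_mem _ (Subgroup.subset_closure (by simp)) _)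
    · rw [Subgroup.closure_le]
      rintro x (rfl | rfl)
      · exact ⟨.a 1, hP1⟩
      · exact ⟨.xa 0, by rw [hφx, hP0, mul_one]⟩

theorem quaternionGroup_two_center : ∀ x : QuaternionGroup 2,
    x * .a 1 = .a 1 * x → x * .xa 0 = .xa 0 * x → x = 1 ∨ x = .a 2 := by
  decide

theorem nonempty_closure_pair_mulEquiv {G : Type*} [Group G] {z a b : G} (hz : VeeLike z)
    (ha : a * a = z) (hb : b * b = z) (hab : a * b = z * (b * a)) :
    Nonempty (Subgroup.closure {a, b} ≃* QuaternionGroup 2) := by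
  obtain ⟨φ, hφ, hr, -⟩ := exists_quaternionGroup_hom hz ha hb hab
  rw [← hr]
  exact ⟨(MonoidHom.ofInjective hφ).symm⟩

theorem card_closure_pair {G : Type*} [Group G] {z a b : G} (hz : VeeLike z)
    (ha : a * a = z) (hb : b * b = z) (hab : a * b = z * (b * a)) :
    Nat.card (Subgroup.closure {a, b}) = 8 := by
  obtain ⟨ψ⟩ := nonempty_closure_pair_mulEquiv hz ha hb hab
  rw [Nat.card_congr ψ.toEquiv, Nat.card_eq_fintype_card, QuaternionGroup.card]

theorem closure_pair_center {G : Type*} [Group G] {z a b : G} (hz : VeeLike z)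
    (ha : a * a = z) (hb : b * b = z) (hab : a * b = z * (b * a)) {x : G}
    (hx : x ∈ Subgroup.closure {a, b}) (hxa : x * a = a * x) (hxb : x * b = b * x) :
    x = 1 ∨ x = z := by
  obtain ⟨φ, hφ, hr, h1, h2, h3⟩ := exists_quaternionGroup_hom hz ha hb hab
  rw [← hr] at hx
  obtain ⟨y, rfl⟩ := hx
  rcases quaternionGroup_two_center y (hφ (by simpa [h1] using hxa)) (hφ (by simpa [h2] using hxb))
    with h | h
  · left; rw [h, map_one]
  · right; rw [h, h3]

namespace VeeLike

variable {G : Type*} [Group G] {z : G}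

theorem orderOf_of_mul_self (hz : VeeLike z) {w : G} (hw : w * w = z) : orderOf w = 4 := by
  have h := orderOf_eq_prime_pow (x := w) (p := 2) (n := 1)
    (by rw [pow_one, pow_two, hw]; exact hz.ne_one)
    (by rw [show 2 ^ (1 + 1) = 2 * 2 from rfl, pow_mul, pow_two w, hw, pow_two, hz.mul_self])
  exact h

/-- In the cyclic group `⟨w⟩` of order 4 the only involution is `w² = z`, which is not in `H`; so
`H` and `⟨w⟩` intersect trivially, and the order assumption makes their product the whole
centralizer. -/
theorem nonempty_centralizer_mulEquiv_complex [Finite G] (hz : VeeLike z) {H : Subgroup G}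
    (hsq : ∀ h ∈ H, h * h = 1) (hcm : H ≤ Subgroup.centralizer (H : Set G)) (hzH : z ∉ H)
    {w : G} (hw : w ∈ Subgroup.centralizer (H : Set G)) (hww : w * w = z)
    (hcard : Nat.card (Subgroup.centralizer (H : Set G)) = Nat.card H * 4) :
    Nonempty (Subgroup.centralizer (H : Set G) ≃* H × Subgroup.zpowers w) := by
  refine nonempty_prod_mulEquiv hcm (by simpa using hw) ?_ ?_ ?_
  · rintro h hh _ ⟨n, rfl⟩
    have := Subgroup.mem_centralizer_iff.1 hw h hh
    exact (Commute.zpow_right this n).eq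
  · rw [Subgroup.disjoint_def]
    rintro _ hx ⟨n, rfl⟩
    have h1 := hsq _ hx
    simp only [← zpow_add] at h1
    have h2 := orderOf_dvd_iff_zpow_eq_one.2 h1
    rw [hz.orderOf_of_mul_self hww] at h2
    -- For `n = 2m` the element is `z^m`, hence `1` or the excluded `z`. Odd `n` contradicts `4 ∣
    -- 2n`.
    rcases Int.even_or_odd n with ⟨m, hm⟩ | ⟨m, hm⟩
    · have h3 : w ^ n = z ^ m := by
        rw [hm, ← two_mul, zpow_mul, zpow_ofNat, pow_two, hww]
      rcases Int.even_or_odd m with ⟨l, hl⟩ | ⟨l, hl⟩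
      · show w ^ n = 1
        rw [h3, hl, ← two_mul, zpow_mul, zpow_ofNat, pow_two, hz.mul_self, one_zpow]
      · have h4 : w ^ n = z := by
          rw [h3, hl, zpow_add, zpow_mul, zpow_ofNat, pow_two, hz.mul_self, one_zpow, one_mul, zpow_one]
        exact (hzH (h4 ▸ hx)).elim
    · omega
  · rw [Nat.card_zpowers, hz.orderOf_of_mul_self hww, hcard]

/-- An element of `H` inside `⟨a, b⟩` commutes with `a` and `b`, so it is in the center `{1, z}` of
the quaternion group; `z ∉ H` leaves only `1`. -/
theorem nonempty_centralizer_mulEquiv_quaternionic [Finite G] (hz : VeeLike z) {H : Subgroup G}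
    (hcm : H ≤ Subgroup.centralizer (H : Set G)) (hzH : z ∉ H)
    {a b : G} (ha : a ∈ Subgroup.centralizer (H : Set G))
    (hb : b ∈ Subgroup.centralizer (H : Set G)) (haa : a * a = z) (hbb : b * b = z)
    (hab : a * b = z * (b * a))
    (hcard : Nat.card (Subgroup.centralizer (H : Set G)) = Nat.card H * 8) :
    Nonempty (Subgroup.centralizer (H : Set G) ≃* H × Subgroup.closure {a, b}) := by
  have hle : Subgroup.closure {a, b} ≤ Subgroup.centralizer (H : Set G) := by
    rw [Subgroup.closure_le]
    rintro x (rfl | rfl)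
    · exact ha
    · exact hb
  refine nonempty_prod_mulEquiv hcm hle ?_ ?_ ?_
  · intro h hh k hk
    exact Subgroup.mem_centralizer_iff.1 (hle hk) h hh
  · rw [Subgroup.disjoint_def]
    intro x hx hxQ
    rcases closure_pair_center hz haa hbb hab hxQ (Subgroup.mem_centralizer_iff.1 ha x hx)
      (Subgroup.mem_centralizer_iff.1 hb x hx) with h | h
    · exact h
    · exact (hzH (h ▸ hx)).elim
  · rw [card_closure_pair hz haa hbb hab, hcard]

end VeeLike

/-! ### Generating tuples of elements of order `2` or `4` -/

/-- `G` is generated by `s` elements, each of order `2` or `4`. -/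
def HasGenerators (G : Type*) [Group G] (s : ℕ) : Prop :=
  ∃ g : Fin s → G, Subgroup.closure (Set.range g) = ⊤ ∧ ∀ i, orderOf (g i) = 2 ∨ orderOf (g i) = 4

namespace HasGenerators

theorem of_mulEquiv {G G' : Type*} [Group G] [Group G'] {s : ℕ} (φ : G ≃* G')
    (h : HasGenerators G' s) : HasGenerators G s := by
  obtain ⟨g, hg, ho⟩ := h
  refine ⟨fun i => φ.symm (g i), ?_, fun i => by rw [MulEquiv.orderOf_eq]; exact ho i⟩
  have h1 : Set.range (fun i => φ.symm (g i)) = φ.symm.toMonoidHom '' Set.range g := by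
    rw [← Set.range_comp]; rfl
  rw [h1, ← MonoidHom.map_closure, hg, ← MonoidHom.range_eq_map, MonoidHom.range_eq_top]
  exact φ.symm.surjective

theorem prod {A B : Type*} [Group A] [Group B] {s t : ℕ} (hA : HasGenerators A s)
    (hB : HasGenerators B t) : HasGenerators (A × B) (s + t) := by
  obtain ⟨g, hg, hgo⟩ := hA
  obtain ⟨h, hh, hho⟩ := hB
  refine ⟨Fin.append (fun i => MonoidHom.inl A B (g i)) (fun i => MonoidHom.inr A B (h i)), ?_, ?_⟩
  · have h0 : ∀ (u : Fin s → A × B) (v : Fin t → A × B),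
        Set.range (Fin.append u v) = Set.range u ∪ Set.range v := fun u v => by
      ext x
      rw [Set.mem_range, finSumFinEquiv.surjective.exists, Sum.exists]
      simp
    rw [h0, Set.range_comp' (MonoidHom.inl A B) g,
      Set.range_comp' (MonoidHom.inr A B) h, Subgroup.closure_union, ← MonoidHom.map_closure,
      ← MonoidHom.map_closure, hg, hh, eq_top_iff]
    rintro ⟨a, b⟩ -
    have h1 : ((a, b) : A × B) = MonoidHom.inl A B a * MonoidHom.inr A B b := by simp
    rw [h1]
    exact mul_mem (Subgroup.mem_sup_left ⟨a, by simp, rfl⟩)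
      (Subgroup.mem_sup_right ⟨b, by simp, rfl⟩)
  · intro i
    refine Fin.addCases (fun i => ?_) (fun i => ?_) i
    · rw [Fin.append_left, orderOf_injective _ (fun x y hxy => congrArg Prod.fst hxy)]
      exact hgo i
    · rw [Fin.append_right, orderOf_injective _ (fun x y hxy => congrArg Prod.snd hxy)]
      exact hho i

theorem zmod {m : ℕ} (hm : m = 2 ∨ m = 4) : HasGenerators (Multiplicative (ZMod m)) 1 := by
  refine ⟨fun _ => Multiplicative.ofAdd 1, ?_, fun _ => ?_⟩
  · rw [Set.range_const, ← Subgroup.zpowers_eq_closure, eq_top_iff]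
    intro x _
    obtain ⟨n, hn⟩ := ZMod.intCast_surjective x.toAdd
    exact ⟨n, by simp only [← ofAdd_zsmul, zsmul_one, hn]; rfl⟩
  · rw [orderOf_ofAdd_eq_addOrderOf, ZMod.addOrderOf_one]
    exact hm

theorem cyclicPower (k : ℕ) : HasGenerators (CyclicPower 2 k) k := by
  refine ⟨fun i => Pi.mulSingle i (Multiplicative.ofAdd 1), ?_, fun i => ?_⟩
  · rw [eq_top_iff]
    intro x _
    rw [← Finset.univ_prod_mulSingle x]
    refine Subgroup.prod_mem _ fun i _ => ?_
    obtain ⟨n, hn⟩ := ZMod.intCast_surjective (x i).toAdd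
    have h1 : x i = Multiplicative.ofAdd (1 : ZMod 2) ^ n := by
      rw [← ofAdd_zsmul, zsmul_one, hn]; rfl
    rw [h1, ← MonoidHom.mulSingle_apply, map_zpow]
    exact Subgroup.zpow_mem _ (Subgroup.subset_closure (Set.mem_range_self i)) _
  · left
    simp only
    refine (orderOf_injective (MonoidHom.mulSingle (fun _ : Fin k => Multiplicative (ZMod 2)) i)
      (fun x y hxy => Pi.mulSingle_injective i hxy) _).trans ?_
    rw [orderOf_ofAdd_eq_addOrderOf, ZMod.addOrderOf_one]

theorem closure_pair {G : Type*} [Group G] {z a b : G} (hz : VeeLike z)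
    (ha : a * a = z) (hb : b * b = z) : HasGenerators (Subgroup.closure {a, b}) 2 := by
  have ha' : a ∈ Subgroup.closure {a, b} := Subgroup.subset_closure (by simp)
  have hb' : b ∈ Subgroup.closure {a, b} := Subgroup.subset_closure (by simp)
  refine ⟨![⟨a, ha'⟩, ⟨b, hb'⟩], ?_, ?_⟩
  · have h1 : Set.range (![⟨a, ha'⟩, ⟨b, hb'⟩] : Fin 2 → Subgroup.closure {a, b}) =
        Subtype.val ⁻¹' {a, b} := by
      ext x
      rw [Matrix.range_cons, Matrix.range_cons, Matrix.range_empty]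
      simp [Subtype.ext_iff, or_comm]
    rw [h1]
    exact Subgroup.closure_closure_coe_preimage
  · intro i
    right
    fin_cases i
    · exact (Subgroup.orderOf_mk a ha').trans (hz.orderOf_of_mul_self ha)
    · exact (Subgroup.orderOf_mk b hb').trans (hz.orderOf_of_mul_self hb)

end HasGenerators

/-! ### Sum of the signs of squares in the vee group -/

theorem veeLike (p q : ℕ) : VeeLike (veeNegOne p q) where
  ne_one := veeNegOne_ne_one p q
  mul_self := veeNegOne_mul_self p q
  central g := veeGroup_ext (by simp)
  sq g := by
    obtain ⟨I, h | h⟩ := veeMonomial_or p q g <;>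
      rcases monomial_mul_self p q I with h1 | h1
    · left; exact veeGroup_ext (by simp [h, h1])
    · right; exact veeGroup_ext (by simp [h, h1])
    · left; exact veeGroup_ext (by simp [h, h1])
    · right; exact veeGroup_ext (by simp [h, h1])
  comm g h := by
    have key : ∀ I J : Finset (Fin (p + q)), monomial p q I * monomial p q J =
        monomial p q J * monomial p q I ∨ monomial p q I * monomial p q J =
        -(monomial p q J * monomial p q I) := fun I J => by
      rw [monomial_mul_comm_eq]
      rcases neg_one_pow_eq_or (Cl p q) (I.card * J.card + (I ∩ J).card) with h | h <;> simp [h]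
    obtain ⟨I, rfl | rfl⟩ := veeMonomial_or p q g <;>
      obtain ⟨J, rfl | rfl⟩ := veeMonomial_or p q h <;>
      exact (key I J).imp (fun h => veeGroup_ext (by simp [h])) fun h => veeGroup_ext (by simp [h])

theorem sqSign_veeMonomial (p q : ℕ) (I : Finset (Fin (p + q))) :
    sqSign (veeMonomial p q I) = (-1) ^ sqExp p I := by
  rcases Nat.even_or_odd (sqExp p I) with h | h
  · rw [h.neg_one_pow, sqSign_eq_one, veeMonomial_mul_self, veeNegOne_pow_eq_one_iff]
    exact Nat.even_iff.1 h
  · rw [h.neg_one_pow, (veeLike p q).sqSign_eq_neg_one, veeMonomial_mul_self]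
    obtain ⟨m, hm⟩ := h
    rw [hm, pow_succ, pow_mul, pow_two, veeNegOne_mul_self, one_pow, one_mul]

/-- The signs `(-1)^(m choose 2)` run through `+, +, -, -` with period four, as does the real part
of `(1 - i) i^m`. Its imaginary part is minus the next real part, which carries the induction. -/
theorem gaussianInt_pow_I (m : ℕ) : (⟨1, -1⟩ * ⟨0, 1⟩ ^ m : GaussianInt) =
    ⟨(-1) ^ m.choose 2, -(-1) ^ (m + 1).choose 2⟩ := by
  induction m with
  | zero => rfl
  | succ m ih =>
    rw [pow_succ, ← mul_assoc, ih]
    ext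
    · simp
    · have h : (m + 1 + 1).choose 2 = m.choose 2 + 2 * m + 1 := by
        rw [Nat.choose_succ_succ' (m + 1) 1, Nat.choose_succ_succ' m 1, Nat.choose_one_right,
          Nat.choose_one_right]
        ring
      rw [h]
      simp [pow_add]

/-- The sign is not multiplicative in `I`, but it is the real part of a constant times a product
over `I`. This lets the sum over all subsets factor. -/
theorem neg_one_pow_sqExp {n : ℕ} (p : ℕ) (I : Finset (Fin n)) :
    (-1 : ℤ) ^ sqExp p I =
      (⟨1, -1⟩ * ∏ i ∈ I, if p ≤ (i : ℕ) then ⟨0, -1⟩ else ⟨0, 1⟩ : GaussianInt).re := by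
  have h1 : (∏ i ∈ I, if p ≤ (i : ℕ) then ⟨0, -1⟩ else ⟨0, 1⟩ : GaussianInt) =
      ⟨0, 1⟩ ^ I.card * ((((-1) ^ (I.filter fun i : Fin n => p ≤ (i : ℕ)).card : ℤ)) :
        GaussianInt) := by
    rw [← Finset.prod_const, Int.cast_pow, ← Finset.prod_const, Finset.prod_filter,
      ← Finset.prod_mul_distrib]
    refine Finset.prod_congr rfl fun i _ => ?_
    split_ifs
    · ext <;> simp
    · simp
  rw [h1, ← mul_assoc, gaussianInt_pow_I, sqExp, pow_add]
  generalize (-1 : ℤ) ^ (I.filter fun i : Fin n => p ≤ (i : ℕ)).card = c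
  simp

/-- Expanding `∏ (1 ± i)` over subsets of the generators gives the sum over all `I`; the factor `2`
accounts for `e_I` and `-e_I`, whose squares agree. -/
theorem sum_sqSign_veeGroup (p q : ℕ) [Fintype (veeGroup p q)] :
    ∑ g : veeGroup p q, sqSign g =
      2 * (⟨1, -1⟩ * (⟨1, 1⟩ ^ p * ⟨1, -1⟩ ^ q) : GaussianInt).re := by
  have h1 : ∀ I : Finset (Fin (p + q)), ∀ s : Bool,
      sqSign (veeOf p q (s, I)) = (-1) ^ sqExp p I := by
    intro I s
    rw [← sqSign_veeMonomial]
    refine sqSign_congr ?_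
    have hz := veeLike p q
    cases s
    · simp [veeOf]
    · have : veeNegOne p q * veeMonomial p q I * (veeNegOne p q * veeMonomial p q I) =
          veeMonomial p q I * veeMonomial p q I := by
        rw [mul_assoc, ← mul_assoc (veeMonomial p q I), hz.central, mul_assoc, hz.z_mul_cancel]
      simp [veeOf, this]
  rw [← Fintype.sum_equiv (Equiv.ofBijective _ (veeOf_bijective p q))
    (fun x => (-1 : ℤ) ^ sqExp p x.2) _ fun x => (h1 x.2 x.1).symm, Fintype.sum_prod_type]
  have h2 : (⟨1, 1⟩ ^ p * ⟨1, -1⟩ ^ q : GaussianInt) =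
      ∏ i : Fin (p + q), (1 + if p ≤ (i : ℕ) then ⟨0, -1⟩ else ⟨0, 1⟩) := by
    rw [Fin.prod_univ_add]
    have h3 : ∀ i : Fin p, ¬ p ≤ (i : ℕ) := fun i => not_le.2 i.2
    simp [h3]
    rfl
  have h4 : ∑ I : Finset (Fin (p + q)), (-1 : ℤ) ^ sqExp p I =
      (⟨1, -1⟩ * (⟨1, 1⟩ ^ p * ⟨1, -1⟩ ^ q) : GaussianInt).re := by
    rw [h2, Finset.prod_one_add, Finset.powerset_univ, Finset.mul_sum, Finset.sum_congr rfl
      fun I _ => neg_one_pow_sqExp p I]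
    let F : GaussianInt →+ ℤ := ⟨⟨Zsqrtd.re, rfl⟩, fun _ _ => rfl⟩
    change _ = F _
    rw [map_sum]
    rfl
  simp only [h4]
  simp

/-- The right-hand side is the value of `2|±H| - |C(H)|` expected when `-1 ∉ H`. The bound `p + q ≤
9` enters here and reduces the identity to finitely many signatures; `k ≤ p + q` ensures that the
truncated subtraction in the exponent is genuine. -/
theorem re_eq_of_radonHurwitz {p q k : ℕ} (h : p + q ≤ 9) (hpq : ((p : ℤ) - q) % 4 ≠ 1)
    (hk : (k : ℤ) = (q : ℤ) - radonHurwitz ((q : ℤ) - p)) :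
    k ≤ p + q ∧ 2 * (⟨1, -1⟩ * (⟨1, 1⟩ ^ p * ⟨1, -1⟩ ^ q) : GaussianInt).re =
      2 * 2 ^ (k + 1) - 2 ^ (p + q + 1 - k) := by
  have key : ∀ p ∈ Finset.range 10, ∀ q ∈ Finset.range 10, p + q ≤ 9 → ((p : ℤ) - q) % 4 ≠ 1 →
      ((q : ℤ) - radonHurwitz ((q : ℤ) - p)).toNat ≤ p + q ∧
      2 * (⟨1, -1⟩ * (⟨1, 1⟩ ^ p * ⟨1, -1⟩ ^ q) : GaussianInt).re =
        2 * 2 ^ (((q : ℤ) - radonHurwitz ((q : ℤ) - p)).toNat + 1) -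
          2 ^ (p + q + 1 - ((q : ℤ) - radonHurwitz ((q : ℤ) - p)).toNat) := by
    decide +kernel
  have h1 := key p (by simp; omega) q (by simp; omega) h hpq
  rwa [← hk, Int.toNat_natCast] at h1

/-! ### The center of the vee group -/

/-- Commuting with `e_j` means that `|I|` and the indicator of `j ∈ I` have the same parity. The
indicator is therefore the same for all `j`. -/
theorem eq_empty_or_univ_of_central {p q : ℕ} {I : Finset (Fin (p + q))}
    (h : ∀ g, g * veeMonomial p q I = veeMonomial p q I * g) :
    I = ∅ ∨ I = Finset.univ ∧ Odd (p + q) := by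
  have h1 : ∀ j, (I.card + if j ∈ I then 1 else 0) % 2 = 0 := by
    intro j
    have h2 := h (veeMonomial p q {j})
    rw [veeMonomial_mul_comm, mul_eq_right, veeNegOne_pow_eq_one_iff, Finset.card_singleton,
      one_mul, Finset.singleton_inter] at h2
    by_cases hj : j ∈ I <;> simpa [hj] using h2
  rcases I.eq_empty_or_nonempty with h2 | ⟨i, hi⟩
  · exact Or.inl h2
  · right
    have h3 : I = Finset.univ := by
      ext j
      simp only [Finset.mem_univ, iff_true]
      by_contra hj
      have h4 := h1 i
      have h5 := h1 j
      rw [if_pos hi] at h4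
      rw [if_neg hj] at h5
      omega
    refine ⟨h3, ?_⟩
    have h4 := h1 i
    rw [if_pos hi, h3, Finset.card_univ, Fintype.card_fin] at h4
    exact Nat.odd_iff.2 (by omega)

theorem central_veeMonomial {p q : ℕ} {g : veeGroup p q} (h : ∀ x, x * g = g * x)
    {I : Finset (Fin (p + q))} (hI : g = veeMonomial p q I ∨ g = veeNegOne p q * veeMonomial p q I)
    (x : veeGroup p q) : x * veeMonomial p q I = veeMonomial p q I * x := by
  rcases hI with rfl | rfl
  · exact h x
  · have h1 := h x
    rw [← mul_assoc, (veeLike p q).central, mul_assoc, mul_assoc] at h1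
    exact mul_left_cancel h1

theorem veeMonomial_empty (p q : ℕ) : veeMonomial p q ∅ = 1 :=
  veeGroup_ext (by simp [monomial_empty])

theorem eq_one_or_of_central_of_even {p q : ℕ} (hn : Even (p + q)) {g : veeGroup p q}
    (h : ∀ x, x * g = g * x) : g = 1 ∨ g = veeNegOne p q := by
  obtain ⟨I, hI⟩ := veeMonomial_or p q g
  rcases eq_empty_or_univ_of_central (central_veeMonomial h hI) with h1 | h1
  · subst h1
    simpa [veeMonomial_empty] using hI
  · exact (Nat.not_even_iff_odd.2 h1.2 hn).elim

theorem sqExp_univ (p q : ℕ) :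
    sqExp p (Finset.univ : Finset (Fin (p + q))) = (p + q).choose 2 + q := by
  unfold sqExp
  rw [Finset.card_univ, Fintype.card_fin, Finset.card_filter, Fin.sum_univ_add]
  have h3 : ∀ i : Fin p, ¬ p ≤ (i : ℕ) := fun i => not_le.2 i.2
  simp [h3]

/-- The only other candidates are `± e_1⋯e_n` with `n` odd, whose square has sign exponent `n(n-1)/2
+ q`. For odd `n` this is even exactly when `p - q ≡ 1 (mod 4)`. -/
theorem eq_one_or_of_central_of_sq {p q : ℕ} (hpq : ((p : ℤ) - q) % 4 ≠ 1) {g : veeGroup p q}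
    (h : ∀ x, x * g = g * x) (hg : g * g = 1) : g = 1 ∨ g = veeNegOne p q := by
  obtain ⟨I, hI⟩ := veeMonomial_or p q g
  have hc := central_veeMonomial h hI
  rcases eq_empty_or_univ_of_central hc with h1 | ⟨h1, hn⟩
  · subst h1
    simpa [veeMonomial_empty] using hI
  · exfalso
    have h2 : veeMonomial p q I * veeMonomial p q I = 1 := by
      rcases hI with rfl | rfl
      · exact hg
      · rwa [mul_assoc, ← mul_assoc (veeMonomial p q I), (veeLike p q).central, mul_assoc,
          (veeLike p q).z_mul_cancel] at hg
    rw [veeMonomial_mul_self, veeNegOne_pow_eq_one_iff, h1, sqExp_univ] at h2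
    obtain ⟨m, hm⟩ := hn
    rw [hm, Nat.choose_two_right, Nat.add_sub_cancel, mul_comm, mul_assoc,
      Nat.mul_div_cancel_left _ (by norm_num)] at h2
    obtain ⟨l, hl | hl⟩ := Nat.even_or_odd' m
    · have : m * (2 * m + 1) = 2 * (l * (2 * m + 1)) := by rw [hl]; ring
      omega
    · have : m * (2 * m + 1) = 2 * (l * (2 * m + 1)) + 2 * m + 1 := by
        nth_rewrite 1 [hl]; ring
      omega

/-! ### Groups generated by commuting involutions -/

theorem closure_le_centralizer {G : Type*} [Group G] {S : Set G}
    (h : ∀ a ∈ S, ∀ b ∈ S, a * b = b * a) :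
    Subgroup.closure S ≤ Subgroup.centralizer (Subgroup.closure S : Set G) := by
  rw [Subgroup.centralizer_closure, Subgroup.closure_le]
  intro a ha
  exact Subgroup.mem_centralizer_iff.2 fun b hb => h b hb a ha

theorem mul_self_of_mem_closure {G : Type*} [Group G] {S : Set G}
    (h : ∀ a ∈ S, ∀ b ∈ S, a * b = b * a) (h2 : ∀ a ∈ S, a * a = 1) :
    ∀ x ∈ Subgroup.closure S, x * x = 1 := by
  intro x hx
  induction hx using Subgroup.closure_induction with
  | mem x hx => exact h2 x hx
  | one => simp
  | mul x y hx hy ihx ihy =>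
    have h3 := Subgroup.mem_centralizer_iff.1 (closure_le_centralizer h hx) y hy
    rw [mul_assoc, ← mul_assoc y, h3, mul_assoc, ihy, mul_one, ihx]
  | inv x hx ih => rw [← mul_inv_rev, ih, inv_one]

/-- In a vee-like group, an involution centralizing an elementary abelian subgroup `N` but not
contained in it does not commute with the whole centralizer of `N`. -/
theorem VeeLike.exists_not_commute {G : Type*} [Group G] [Finite G] {z : G} (hz : VeeLike z)
    (hc : ∀ g : G, (∀ x, x * g = g * x) → g * g = 1 → g = 1 ∨ g = z) {N : Subgroup G}
    (hzN : z ∈ N) (hsq : ∀ h ∈ N, h * h = 1) (hcm : N ≤ Subgroup.centralizer (N : Set G)) {v : G}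
    (hv : v ∈ Subgroup.centralizer (N : Set G)) (hvN : v ∉ N) (hvv : v * v = 1) :
    ∃ g ∈ Subgroup.centralizer (N : Set G), g * v = z * (v * g) := by
  set S : Set G := insert v (N : Set G) with hS
  have hNv := Subgroup.mem_centralizer_iff.1 hv
  have hcomm : ∀ a ∈ S, ∀ b ∈ S, a * b = b * a := by
    rintro a (rfl | ha) b (rfl | hb)
    · rfl
    · exact (hNv b hb).symm
    · exact hNv a ha
    · exact Subgroup.mem_centralizer_iff.1 (hcm hb) a ha
  have hsq' : ∀ a ∈ S, a * a = 1 := by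
    rintro a (rfl | ha)
    · exact hvv
    · exact hsq a ha
  have hNle : N ≤ Subgroup.closure S := fun x hx => Subgroup.subset_closure (Or.inr hx)
  have hvS : v ∈ Subgroup.closure S := Subgroup.subset_closure (Or.inl rfl)
  have h1 := hz.card_mul_card_centralizer N hzN fun h hh hcen => hc h hcen (hsq h hh)
  have h2 := hz.card_mul_card_centralizer (Subgroup.closure S) (hNle hzN)
    fun h hh hcen => hc h hcen (mul_self_of_mem_closure hcomm hsq' h hh)
  -- If `v` commuted with all of `C(N)`, adding `v` would enlarge `N` without shrinking its
  -- centralizer, although in both cases the product of the two orders is `2|G|`.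
  by_contra! hcon
  have h3 : Subgroup.centralizer (N : Set G) ≤
      Subgroup.centralizer (Subgroup.closure S : Set G) := by
    rw [Subgroup.centralizer_closure]
    intro g hg
    rw [Subgroup.mem_centralizer_iff]
    rintro h (rfl | hh)
    · exact ((hz.comm g h).resolve_right (hcon g hg)).symm
    · exact Subgroup.mem_centralizer_iff.1 hg h hh
  have h4 : Nat.card N < Nat.card (Subgroup.closure S) := by
    refine lt_of_le_of_ne (Nat.le_of_dvd Nat.card_pos (Subgroup.card_dvd_of_le hNle)) fun h => ?_
    exact hvN ((Subgroup.eq_of_le_of_card_ge hNle h.ge).symm ▸ hvS)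
  have h5 := Nat.le_of_dvd Nat.card_pos (Subgroup.card_dvd_of_le h3)
  have h6 : 0 < Nat.card (Subgroup.centralizer (Subgroup.closure S : Set G)) := Nat.card_pos
  have h7 := Nat.mul_lt_mul_of_lt_of_le h4 h5 h6
  omega

/-! ### The idempotent and its stabilizer -/

/-- The group generated by the monomials `e_{I_1}, …, e_{I_k}`. -/
abbrev familyGroup (p q : ℕ) {k : ℕ} (I : Fin k → Finset (Fin (p + q))) :
    Subgroup (veeGroup p q) :=
  Subgroup.closure (Set.range fun j => veeMonomial p q (I j))

theorem commute_productElt {p q k : ℕ} {I : Fin k → Finset (Fin (p + q))} {ε : Fin k → ℤˣ}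
    {x : Cl p q} (h : ∀ j, Commute x (monomial p q (I j))) : Commute x (productElt p q I ε) := by
  refine Commute.list_prod_right _ _ fun y hy => ?_
  obtain ⟨j, rfl⟩ := (List.mem_ofFn' _ _).1 hy
  exact ((Commute.one_right x).add_right (Commute.smul_right (h j) _)).smul_right _

theorem mul_list_prod_eq_zsmul {A : Type*} [Ring A] {y : A} {s : ℤ} {l : List A}
    (hy : ∀ x ∈ l, Commute y x) {x : A} (hx : x ∈ l) (h : y * x = s • x) :
    y * l.prod = s • l.prod := by
  induction l with
  | nil => simp at hx
  | cons a l ih =>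
    rw [List.prod_cons, ← mul_assoc]
    rcases List.mem_cons.1 hx with rfl | hx
    · rw [h, smul_mul_assoc]
    · rw [(hy a List.mem_cons_self).eq, mul_assoc,
        ih (fun x hx => hy x (List.mem_cons_of_mem _ hx)) hx, mul_smul_comm]

namespace IsCommutingFamily

variable {p q k : ℕ} {I : Fin k → Finset (Fin (p + q))}

/-- From `e² = 1` one gets `e(1 ± e) = ±(1 ± e)`, and `e_{I_j}` commutes past the other factors to
reach its own. -/
theorem monomial_mul_productElt (hI : IsCommutingFamily p q I) (ε : Fin k → ℤˣ) (j : Fin k) :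
    monomial p q (I j) * productElt p q I ε = ((ε j : ℤˣ) : ℤ) • productElt p q I ε := by
  refine mul_list_prod_eq_zsmul (fun x hx => ?_) ((List.mem_ofFn' _ _).2 (Set.mem_range_self j)) ?_
  · obtain ⟨i, rfl⟩ := (List.mem_ofFn' _ _).1 hx
    exact ((Commute.one_right _).add_right (Commute.smul_right (hI.comm j i) _)).smul_right _
  · rw [mul_smul_comm, mul_add, mul_one, mul_smul_comm, hI.sq_eq_one, smul_comm _ (1 / 2 : ℝ)]
    congr 1
    rcases Int.units_eq_one_or (ε j) with h | h <;> simp [h, add_comm]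

theorem veeMonomial_comm (hI : IsCommutingFamily p q I) :
    ∀ a ∈ Set.range (fun j => veeMonomial p q (I j)),
      ∀ b ∈ Set.range (fun j => veeMonomial p q (I j)), a * b = b * a := by
  rintro _ ⟨i, rfl⟩ _ ⟨j, rfl⟩
  exact veeGroup_ext (by simpa using hI.comm i j)

theorem le_centralizer (hI : IsCommutingFamily p q I) :
    familyGroup p q I ≤ Subgroup.centralizer (familyGroup p q I : Set (veeGroup p q)) :=
  closure_le_centralizer hI.veeMonomial_comm

theorem mul_self (hI : IsCommutingFamily p q I) : ∀ h ∈ familyGroup p q I, h * h = 1 := by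
  refine mul_self_of_mem_closure hI.veeMonomial_comm ?_
  rintro _ ⟨i, rfl⟩
  exact veeGroup_ext (by simpa using hI.sq_eq_one i)

theorem mem_stab_iff {f : Cl p q} {g : veeGroup p q} :
    g ∈ stab p q f ↔ ((g : (Cl p q)ˣ) : Cl p q) * f = f * ((g : (Cl p q)ˣ) : Cl p q) :=
  Units.mul_inv_eq_iff_eq_mul (g : (Cl p q)ˣ)

theorem mem_centralizer_iff {g : veeGroup p q} :
    g ∈ Subgroup.centralizer (familyGroup p q I : Set (veeGroup p q)) ↔
      ∀ j, ((g : (Cl p q)ˣ) : Cl p q) * monomial p q (I j) =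
        monomial p q (I j) * ((g : (Cl p q)ˣ) : Cl p q) := by
  rw [Subgroup.centralizer_closure, Subgroup.mem_centralizer_iff, Set.forall_mem_range]
  refine forall_congr' fun j => ⟨fun h => ?_, fun h => ?_⟩
  · simpa using (congrArg (fun g : veeGroup p q => ((g : (Cl p q)ˣ) : Cl p q)) h).symm
  · exact veeGroup_ext (by simpa using h.symm)

/-- The stabilizer of a nonzero product of this form is the centralizer of the monomials. -/
theorem stab_eq_centralizer (hI : IsCommutingFamily p q I) {ε : Fin k → ℤˣ}
    (hf : productElt p q I ε ≠ 0) :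
    stab p q (productElt p q I ε) =
      Subgroup.centralizer (familyGroup p q I : Set (veeGroup p q)) := by
  ext g
  rw [mem_stab_iff, mem_centralizer_iff]
  constructor
  · intro hg j
    set f := productElt p q I ε
    have h1 := hI.monomial_mul_productElt ε j
    rcases (veeLike p q).comm g (veeMonomial p q (I j)) with h | h
    · simpa using congrArg (fun g : veeGroup p q => ((g : (Cl p q)ˣ) : Cl p q)) h
    -- If `g` anticommuted with `e_{I_j}`, then `e_{I_j}` would act on `g f = f g` both by `ε_j` and
    -- by `-ε_j`. This forces `g f = 0`, hence `f = 0`.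
    · exfalso
      have h2 : ((g : (Cl p q)ˣ) : Cl p q) * monomial p q (I j) =
          -(monomial p q (I j) * ((g : (Cl p q)ˣ) : Cl p q)) := by
        simpa using congrArg (fun g : veeGroup p q => ((g : (Cl p q)ˣ) : Cl p q)) h
      have h3 : ((ε j : ℤˣ) : ℤ) • (((g : (Cl p q)ˣ) : Cl p q) * f) =
          -(((ε j : ℤˣ) : ℤ) • (((g : (Cl p q)ˣ) : Cl p q) * f)) := by
        nth_rewrite 1 [← mul_smul_comm]
        rw [← h1, ← mul_assoc, h2, neg_mul, mul_assoc, hg, ← mul_assoc, h1, smul_mul_assoc]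
      have h4 := eq_zero_of_eq_neg h3
      rcases Int.units_eq_one_or (ε j) with h | h <;> simp [h] at h4 <;> exact hf h4
  · intro hg
    exact commute_productElt hg

end IsCommutingFamily

/-- If the product is a primitive idempotent, then all elements of the stabilizer outside
`±⟨e_{I_1}, …, e_{I_k}⟩` have square `-1`. -/
theorem mul_self_of_isPrimitiveIdempotent {p q k : ℕ} {I : Fin k → Finset (Fin (p + q))}
    (hpq : ((p : ℤ) - q) % 4 ≠ 1) (hI : IsCommutingFamily p q I) {ε : Fin k → ℤˣ}
    (hf : IsPrimitiveIdempotent (productElt p q I ε)) {v : veeGroup p q}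
    (hv : v ∈ Subgroup.centralizer (familyGroup p q I : Set (veeGroup p q)))
    (hvN : v ∉ (veeLike p q).adjoin (familyGroup p q I)) : v * v = veeNegOne p q := by
  have hz := veeLike p q
  refine (hz.sq v).resolve_left fun hvv => ?_
  -- Suppose `v² = 1`. This `g` centralizes `H`, so it commutes with `f`, but it anticommutes with
  -- `v`.
  obtain ⟨g, hg, hgv⟩ := hz.exists_not_commute
    (fun g h h2 => eq_one_or_of_central_of_sq hpq h h2) (hz.z_mem_adjoin (familyGroup p q I))
    (hz.sq_adjoin hI.mul_self) (hz.adjoin_le_centralizer hI.le_centralizer)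
    (by rwa [hz.centralizer_adjoin]) hvN hvv
  rw [hz.centralizer_adjoin] at hg
  set f := productElt p q I ε with hfdef
  obtain ⟨hf0, hff, hprim⟩ := hf
  set x : Cl p q := ((v : (Cl p q)ˣ) : Cl p q) with hx
  set y : Cl p q := ((g : (Cl p q)ˣ) : Cl p q) with hy
  have hxx : x * x = 1 := by
    simpa using congrArg (fun g : veeGroup p q => ((g : (Cl p q)ˣ) : Cl p q)) hvv
  have hyx : y * x = -(x * y) := by
    simpa using congrArg (fun g : veeGroup p q => ((g : (Cl p q)ˣ) : Cl p q)) hgv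
  have hxf : x * f = f * x := commute_productElt (IsCommutingFamily.mem_centralizer_iff.1 hv)
  have hyf : y * f = f * y := commute_productElt (IsCommutingFamily.mem_centralizer_iff.1 hg)
  have hfx : f * x * f = f * x := by rw [mul_assoc, hxf, ← mul_assoc, hff]
  have hfxx : f * x * x = f := by rw [mul_assoc, hxx, mul_one]
  have hfxfx : f * x * (f * x) = f := by rw [← mul_assoc, hfx, hfxx]
  have hffx : f * (f * x) = f * x := by rw [← mul_assoc, hff]
  -- The orthogonal idempotents `f(1 ± x)/2` sum to `f`, so primitivity makes one of them vanish.
  have key : f * x = f ∨ f * x = -f := by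
    have h := hprim ((1 / 2 : ℝ) • (f + f * x)) ((1 / 2 : ℝ) • (f - f * x)) ?_ ?_ ?_ ?_ ?_
    · rcases h with h | h
      · right
        have h1 : f + f * x = 0 := (smul_eq_zero.1 h).resolve_left (by norm_num)
        exact (neg_eq_of_add_eq_zero_right h1).symm
      · left
        have h1 : f - f * x = 0 := (smul_eq_zero.1 h).resolve_left (by norm_num)
        exact (sub_eq_zero.1 h1).symm
    · rw [smul_mul_smul_comm]
      simp only [mul_add, add_mul, hff, hfx, hffx, hfxfx]
      module
    · rw [smul_mul_smul_comm]
      simp only [mul_sub, sub_mul, hff, hfx, hffx, hfxfx]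
      module
    · rw [smul_mul_smul_comm]
      simp only [mul_sub, add_mul, hff, hfx, hffx, hfxfx]
      module
    · rw [smul_mul_smul_comm]
      simp only [mul_add, sub_mul, hff, hfx, hffx, hfxfx]
      module
    · module
  -- Passing `y` through `f x` reverses the sign, while passing it through `± f` does not; so `f y =
  -- 0` although `y` is a unit.
  have h1 : y * (f * x) = -(f * x * y) := by
    rw [← mul_assoc, hyf, mul_assoc, hyx, mul_neg, mul_assoc]
  have h2 : f * y = 0 := by
    rcases key with h | h
    · rw [h, hyf] at h1
      exact eq_zero_of_eq_neg h1
    · rw [h, mul_neg, hyf, neg_mul, neg_neg] at h1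
      exact eq_zero_of_eq_neg h1.symm
  exact hf0 ((Units.mul_left_eq_zero (g : (Cl p q)ˣ)).1 h2)

/-- The monomials generate a group not containing `-1`, its centralizer has order `2^{n+1-k}`, and
all elements of the centralizer outside `±⟨e_{I_1}, …, e_{I_k}⟩` have square `-1`. -/
structure OrderData (p q k : ℕ) (I : Fin k → Finset (Fin (p + q))) : Prop where
  negOne_notMem : veeNegOne p q ∉ familyGroup p q I
  card_centralizer : Nat.card (Subgroup.centralizer (familyGroup p q I : Set (veeGroup p q))) =
    2 ^ (p + q + 1 - k)
  mul_self : ∀ v ∈ Subgroup.centralizer (familyGroup p q I : Set (veeGroup p q)),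
    v ∉ (veeLike p q).adjoin (familyGroup p q I) → v * v = veeNegOne p q

theorem card_adjoin_mul_card_centralizer {p q k : ℕ} (hpq : ((p : ℤ) - q) % 4 ≠ 1)
    {I : Fin k → Finset (Fin (p + q))} (hI : IsCommutingFamily p q I) :
    Nat.card ((veeLike p q).adjoin (familyGroup p q I)) *
      Nat.card (Subgroup.centralizer (familyGroup p q I : Set (veeGroup p q))) =
      2 ^ (p + q + 2) := by
  have hz := veeLike p q
  have h := hz.card_mul_card_centralizer (hz.adjoin (familyGroup p q I)) (hz.z_mem_adjoin _)
    fun h hh hcen => eq_one_or_of_central_of_sq hpq hcen (hz.sq_adjoin hI.mul_self h hh)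
  rw [hz.centralizer_adjoin, card_veeGroup] at h
  rw [h]
  ring

/-- Primitivity gives equality in the estimate for the sum of square signs. Comparison with its
Radon–Hurwitz value then decides whether `-1` lies in `H`. -/
theorem orderData_of_isPrimitiveIdempotent {p q k : ℕ} (h9 : p + q ≤ 9)
    (hpq : ((p : ℤ) - q) % 4 ≠ 1) (hk : (k : ℤ) = (q : ℤ) - radonHurwitz ((q : ℤ) - p))
    {I : Fin k → Finset (Fin (p + q))} (hI : IsCommutingFamily p q I) {ε : Fin k → ℤˣ}
    (hf : IsPrimitiveIdempotent (productElt p q I ε)) : OrderData p q k I := by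
  have hz := veeLike p q
  let _ := Fintype.ofFinite (veeGroup p q)
  have h1 := card_adjoin_mul_card_centralizer hpq hI
  have h2 := fun v => mul_self_of_isPrimitiveIdempotent hpq hI hf (v := v)
  have h3 := (hz.sum_sqSign_eq_iff (hz.adjoin (familyGroup p q I)) (hz.sq_adjoin hI.mul_self)
    (hz.adjoin_le_centralizer hI.le_centralizer)).2 (by rwa [hz.centralizer_adjoin])
  obtain ⟨hkn, h4⟩ := re_eq_of_radonHurwitz h9 hpq hk
  rw [sum_sqSign_veeGroup, h4, hz.centralizer_adjoin] at h3
  have h5 : Nat.card (familyGroup p q I) = 2 ^ k := hI.card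
  obtain ⟨m, hm⟩ := Nat.exists_eq_add_of_le hkn
  rw [show p + q + 2 = k + m + 2 by omega] at h1
  have h7 : p + q + 1 - k = m + 1 := by omega
  rw [h7] at h3
  have hpos : 0 < 2 ^ k := by positivity
  -- With `p + q = k + m`, `-1 ∈ H` would give `|±H| = 2^k` and `|C| = 2^(m+2)`, so `2^(k+1) -
  -- 2^(m+2) = 2^(k+2) - 2^(m+1)`; but the left side is smaller.
  have hnot : veeNegOne p q ∉ familyGroup p q I := by
    intro hmem
    rw [hz.adjoin_eq_self hmem, h5] at h1 h3
    rw [show k + m + 2 = k + (m + 2) by ring, pow_add 2 k] at h1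
    have h6 := Nat.eq_of_mul_eq_mul_left hpos h1
    rw [h6] at h3
    push_cast at h3
    have : (0 : ℤ) < 2 ^ k := by positivity
    have : (0 : ℤ) < 2 ^ m := by positivity
    rw [pow_succ, pow_succ, pow_add] at h3
    linarith
  refine ⟨hnot, ?_, h2⟩
  rw [hz.card_adjoin hnot, h5, show k + m + 2 = k + (m + 2) by ring, pow_add 2 k, mul_comm 2,
    mul_assoc] at h1
  have h6 := Nat.eq_of_mul_eq_mul_left hpos h1
  rw [h7]
  rw [pow_succ] at h6 ⊢
  omega

/-- Here `-1 ∉ H` gives both orders directly, so the sum of square signs attains its lower bound,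
and this forces the squares outside `±H`. It serves the tables, where primitivity is not assumed. -/
theorem orderData_of_negOne_notMem {p q k : ℕ} (h9 : p + q ≤ 9)
    (hpq : ((p : ℤ) - q) % 4 ≠ 1) (hk : (k : ℤ) = (q : ℤ) - radonHurwitz ((q : ℤ) - p))
    {I : Fin k → Finset (Fin (p + q))} (hI : IsCommutingFamily p q I)
    (hnot : veeNegOne p q ∉ familyGroup p q I) : OrderData p q k I := by
  have hz := veeLike p q
  let _ := Fintype.ofFinite (veeGroup p q)
  have h1 := card_adjoin_mul_card_centralizer hpq hI
  have h3 := (hz.sum_sqSign_eq_iff (hz.adjoin (familyGroup p q I)) (hz.sq_adjoin hI.mul_self)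
    (hz.adjoin_le_centralizer hI.le_centralizer)).1
  obtain ⟨hkn, h4⟩ := re_eq_of_radonHurwitz h9 hpq hk
  rw [sum_sqSign_veeGroup, h4, hz.centralizer_adjoin] at h3
  have h5 : Nat.card (familyGroup p q I) = 2 ^ k := hI.card
  obtain ⟨m, hm⟩ := Nat.exists_eq_add_of_le hkn
  have h7 : p + q + 1 - k = m + 1 := by omega
  have hpos : 0 < 2 ^ k := by positivity
  have h8 : Nat.card (hz.adjoin (familyGroup p q I)) = 2 ^ (k + 1) := by
    rw [hz.card_adjoin hnot, h5, pow_succ, mul_comm]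
  have h6 : Nat.card (Subgroup.centralizer (familyGroup p q I : Set (veeGroup p q))) =
      2 ^ (m + 1) := by
    rw [h8, show p + q + 2 = (k + 1) + (m + 1) by omega, pow_add 2 (k + 1)] at h1
    exact Nat.eq_of_mul_eq_mul_left (by positivity) h1
  rw [h7] at h3
  refine ⟨hnot, by rw [h7, h6], h3 ?_⟩
  rw [h8, h6]
  push_cast
  ring

/-! ### The group `F_2` -/

theorem veeMonomial_mul_self_eq_one_iff {p q : ℕ} {I : Finset (Fin (p + q))} :
    veeMonomial p q I * veeMonomial p q I = 1 ↔ sqExp p I % 2 = 0 := by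
  rw [veeMonomial_mul_self, veeNegOne_pow_eq_one_iff]

theorem veeMonomial_mul_self_eq_negOne {p q : ℕ} {I : Finset (Fin (p + q))}
    (h : sqExp p I % 2 = 1) : veeMonomial p q I * veeMonomial p q I = veeNegOne p q :=
  ((veeLike p q).sq _).resolve_left fun h1 => by
    rw [veeMonomial_mul_self_eq_one_iff] at h1
    omega

theorem veeMonomial_commute_iff {p q : ℕ} {I J : Finset (Fin (p + q))} :
    veeMonomial p q I * veeMonomial p q J = veeMonomial p q J * veeMonomial p q I ↔
      (I.card * J.card + (I ∩ J).card) % 2 = 0 := by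
  rw [veeMonomial_mul_comm, mul_eq_right, veeNegOne_pow_eq_one_iff]

theorem F2_mul_self (i : ℕ) (hi : i = 2 ∨ i = 3) :
    veeMonomial 1 3 (idx 1 3 [i]) * veeMonomial 1 3 (idx 1 3 [i]) = veeNegOne 1 3 := by
  apply veeMonomial_mul_self_eq_negOne
  rcases hi with rfl | rfl <;> decide

theorem F2_mul_comm : veeMonomial 1 3 (idx 1 3 [2]) * veeMonomial 1 3 (idx 1 3 [3]) =
    veeNegOne 1 3 * (veeMonomial 1 3 (idx 1 3 [3]) * veeMonomial 1 3 (idx 1 3 [2])) := by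
  refine ((veeLike 1 3).comm _ _).resolve_left fun h => ?_
  rw [veeMonomial_commute_iff] at h
  revert h
  decide

theorem card_F2 : Nat.card F2 = 8 :=
  card_closure_pair (veeLike 1 3) (F2_mul_self 2 (by simp)) (F2_mul_self 3 (by simp)) F2_mul_comm

theorem nonempty_F2_mulEquiv : Nonempty (F2 ≃* QuaternionGroup 2) :=
  nonempty_closure_pair_mulEquiv (veeLike 1 3) (F2_mul_self 2 (by simp)) (F2_mul_self 3 (by simp))
    F2_mul_comm

theorem F2_hasGenerators : HasGenerators F2 2 :=
  HasGenerators.closure_pair (veeLike 1 3) (F2_mul_self 2 (by simp)) (F2_mul_self 3 (by simp))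

/-! ### Isomorphism types of the stabilizer -/

/-- The difference `n - 2k` is the exponent of the index of `±H` in the stabilizer; in this and the
next two lemmas it is `0`, `1`, `2`, so that the index is the real dimension of the division ring.
-/
theorem radonHurwitz_real {p q k : ℕ} (hpq : ((p : ℤ) - q) % 4 ≠ 1)
    (hk : (k : ℤ) = (q : ℤ) - radonHurwitz ((q : ℤ) - p))
    (h : ((p : ℤ) - q) % 8 ∈ ({0, 1, 2} : Set ℤ)) : p + q = 2 * k := by
  simp only [Set.mem_insert_iff, Set.mem_singleton_iff] at h
  unfold radonHurwitz at hk
  split_ifs at hk <;> omega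

theorem radonHurwitz_complex {p q k : ℕ}
    (hk : (k : ℤ) = (q : ℤ) - radonHurwitz ((q : ℤ) - p))
    (h : ((p : ℤ) - q) % 8 ∈ ({3, 7} : Set ℤ)) : p + q = 2 * k + 1 := by
  simp only [Set.mem_insert_iff, Set.mem_singleton_iff] at h
  unfold radonHurwitz at hk
  split_ifs at hk <;> omega

theorem radonHurwitz_quaternionic {p q k : ℕ} (hpq : ((p : ℤ) - q) % 4 ≠ 1)
    (hk : (k : ℤ) = (q : ℤ) - radonHurwitz ((q : ℤ) - p))
    (h : ((p : ℤ) - q) % 8 ∈ ({4, 5, 6} : Set ℤ)) : p + q = 2 * k + 2 := by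
  simp only [Set.mem_insert_iff, Set.mem_singleton_iff] at h
  unfold radonHurwitz at hk
  split_ifs at hk <;> omega

theorem nonempty_familyGroup_mulEquiv {p q k : ℕ} {I : Fin k → Finset (Fin (p + q))}
    (hI : IsCommutingFamily p q I) : Nonempty (familyGroup p q I ≃* CyclicPower 2 k) :=
  nonempty_mulEquiv_cyclicPower_two (fun h => Subtype.ext (hI.mul_self h h.2)) hI.card

namespace OrderData

variable {p q k : ℕ} {I : Fin k → Finset (Fin (p + q))}

theorem card_adjoin (D : OrderData p q k I) (hI : IsCommutingFamily p q I) :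
    Nat.card ((veeLike p q).adjoin (familyGroup p q I)) = 2 ^ (k + 1) := by
  have h : Nat.card (familyGroup p q I) = 2 ^ k := hI.card
  rw [(veeLike p q).card_adjoin D.negOne_notMem, h, pow_succ, mul_comm]

theorem adjoin_le (hI : IsCommutingFamily p q I) :
    (veeLike p q).adjoin (familyGroup p q I) ≤
      Subgroup.centralizer (familyGroup p q I : Set (veeGroup p q)) :=
  ((veeLike p q).adjoin_le_centralizer hI.le_centralizer).trans
    ((veeLike p q).centralizer_adjoin _).le

theorem centralizer_eq_adjoin (D : OrderData p q k I) (hI : IsCommutingFamily p q I)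
    (hn : p + q = 2 * k) :
    Subgroup.centralizer (familyGroup p q I : Set (veeGroup p q)) =
      (veeLike p q).adjoin (familyGroup p q I) := by
  refine (Subgroup.eq_of_le_of_card_ge (adjoin_le hI) ?_).symm
  rw [D.card_adjoin hI, D.card_centralizer, show p + q + 1 - k = k + 1 by omega]

theorem mulEquiv_real (D : OrderData p q k I) (hI : IsCommutingFamily p q I)
    (hn : p + q = 2 * k) :
    Nonempty (Subgroup.centralizer (familyGroup p q I : Set (veeGroup p q)) ≃*
      CyclicPower 2 (k + 1)) := by
  rw [D.centralizer_eq_adjoin hI hn]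
  exact nonempty_mulEquiv_cyclicPower_two
    (fun h => Subtype.ext ((veeLike p q).sq_adjoin hI.mul_self h h.2)) (D.card_adjoin hI)

theorem exists_notMem (D : OrderData p q k I) (hI : IsCommutingFamily p q I)
    (hn : k + 1 < p + q + 1 - k) :
    ∃ w ∈ Subgroup.centralizer (familyGroup p q I : Set (veeGroup p q)),
      w ∉ (veeLike p q).adjoin (familyGroup p q I) := by
  by_contra! h
  have h1 := Subgroup.card_dvd_of_le (show _ ≤ _ from h)
  rw [D.card_adjoin hI, D.card_centralizer, Nat.pow_dvd_pow_iff_le_right (by norm_num)] at h1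
  omega

theorem mulEquiv_complex (D : OrderData p q k I) (hI : IsCommutingFamily p q I)
    (hn : p + q = 2 * k + 1) :
    Nonempty (Subgroup.centralizer (familyGroup p q I : Set (veeGroup p q)) ≃*
      CyclicPower 2 k × Multiplicative (ZMod 4)) := by
  obtain ⟨w, hw, hwN⟩ := D.exists_notMem hI (by omega)
  have hww := D.mul_self w hw hwN
  have h : Nat.card (familyGroup p q I) = 2 ^ k := hI.card
  obtain ⟨φ⟩ := (veeLike p q).nonempty_centralizer_mulEquiv_complex hI.mul_self hI.le_centralizer
    D.negOne_notMem hw hww (by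
      rw [D.card_centralizer, h, show p + q + 1 - k = k + 2 by omega, pow_add]
      rfl)
  obtain ⟨ψ⟩ := nonempty_familyGroup_mulEquiv hI
  obtain ⟨χ⟩ := nonempty_zpowers_mulEquiv ((veeLike p q).orderOf_of_mul_self hww)
  exact ⟨φ.trans (MulEquiv.prodCongr ψ χ)⟩

theorem mulEquiv_quaternionic (D : OrderData p q k I) (hI : IsCommutingFamily p q I)
    (hn : p + q = 2 * k + 2) :
    Nonempty (Subgroup.centralizer (familyGroup p q I : Set (veeGroup p q)) ≃*
      F2 × CyclicPower 2 k) := by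
  have hz := veeLike p q
  set C := Subgroup.centralizer (familyGroup p q I : Set (veeGroup p q)) with hC
  have hNC : hz.adjoin (familyGroup p q I) ≤ C := adjoin_le hI
  -- For even `n` the center is `{1, z}`, so an abelian `C` would satisfy `|C|² ≤ 2|G|`. But `|C|² =
  -- 2^(2k+6)` and `2|G| = 2^(2k+4)`.
  have h1 : ∃ a ∈ C, ∃ b ∈ C, a * b ≠ b * a := by
    by_contra! hcon
    have h2 : C ≤ Subgroup.centralizer (C : Set (veeGroup p q)) := fun a ha =>
      Subgroup.mem_centralizer_iff.2 fun b hb => hcon b hb a ha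
    have h3 := hz.card_mul_card_centralizer C (hNC (hz.z_mem_adjoin _))
      fun h _ hcen => eq_one_or_of_central_of_even ⟨k + 1, by omega⟩ hcen
    have h4 := Nat.le_of_dvd Nat.card_pos (Subgroup.card_dvd_of_le h2)
    have h5 := Nat.mul_le_mul_left (Nat.card C) h4
    rw [h3, card_veeGroup, D.card_centralizer, ← pow_add, ← pow_succ',
      Nat.pow_le_pow_iff_right (by norm_num)] at h5
    omega
  obtain ⟨a, ha, b, hb, hab⟩ := h1
  -- All of `±H` is central in `C`, so elements that fail to commute lie outside it and have square
  -- `-1`.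
  have hout : ∀ x ∈ C, ∀ y ∈ C, x * y ≠ y * x → x ∉ hz.adjoin (familyGroup p q I) := by
    intro x _ y hy hxy hx
    rw [hC, ← hz.centralizer_adjoin] at hy
    exact hxy (Subgroup.mem_centralizer_iff.1 hy x hx)
  have haa := D.mul_self a ha (hout a ha b hb hab)
  have hbb := D.mul_self b hb (hout b hb a ha hab.symm)
  have hab' := (hz.comm a b).resolve_left hab
  have h : Nat.card (familyGroup p q I) = 2 ^ k := hI.card
  obtain ⟨φ⟩ := hz.nonempty_centralizer_mulEquiv_quaternionic hI.le_centralizer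
    D.negOne_notMem ha hb haa hbb hab' (by
      rw [D.card_centralizer, h, show p + q + 1 - k = k + 3 by omega, pow_add]
      rfl)
  obtain ⟨ψ⟩ := nonempty_familyGroup_mulEquiv hI
  obtain ⟨χ⟩ := nonempty_closure_pair_mulEquiv hz haa hbb hab'
  obtain ⟨χ'⟩ := nonempty_F2_mulEquiv
  exact ⟨(φ.trans (MulEquiv.prodCongr ψ (χ.trans χ'.symm))).trans MulEquiv.prodComm⟩

theorem isPGroup (D : OrderData p q k I) :
    IsPGroup 2 (Subgroup.centralizer (familyGroup p q I : Set (veeGroup p q))) :=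
  IsPGroup.of_card D.card_centralizer

end OrderData

theorem F2_not_comm : ¬ ∀ a b : F2, a * b = b * a := by
  intro h
  have h1 := congrArg Subtype.val (h ⟨_, Subgroup.subset_closure (Or.inl rfl)⟩
    ⟨_, Subgroup.subset_closure (Or.inr rfl)⟩)
  simp only [Subgroup.coe_mul] at h1
  rw [veeMonomial_commute_iff] at h1
  revert h1
  decide

/-! ### Sign computations with lists of indices -/

/-- A list of distinct one-based indices. -/
def ValidList (n : ℕ) (l : List ℕ) : Prop := l.Nodup ∧ ∀ x ∈ l, 1 ≤ x ∧ x ≤ n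

instance (n : ℕ) (l : List ℕ) : Decidable (ValidList n l) :=
  inferInstanceAs (Decidable (_ ∧ _))

theorem mem_idx {p q : ℕ} {l : List ℕ} {i : Fin (p + q)} : i ∈ idx p q l ↔ (i : ℕ) + 1 ∈ l := by
  simp [idx]

theorem ValidList.filter {n : ℕ} {l : List ℕ} (h : ValidList n l) (P : ℕ → Bool) :
    ValidList n (l.filter P) :=
  ⟨h.1.filter _, fun x hx => h.2 x (List.mem_of_mem_filter hx)⟩

theorem ValidList.card_idx {p q : ℕ} {l : List ℕ} (h : ValidList (p + q) l) :
    (idx p q l).card = l.length := by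
  rw [← List.toFinset_card_of_nodup h.1]
  refine Finset.card_bij (fun i _ => (i : ℕ) + 1) (fun i hi => ?_) (fun i _ j _ hij => ?_)
    fun x hx => ?_
  · rw [List.mem_toFinset]
    exact mem_idx.1 hi
  · exact Fin.ext (by simpa using hij)
  · rw [List.mem_toFinset] at hx
    obtain ⟨h1, h2⟩ := h.2 x hx
    refine ⟨⟨x - 1, by omega⟩, mem_idx.2 ?_, ?_⟩
    · simpa [Nat.sub_add_cancel h1] using hx
    · simp [Nat.sub_add_cancel h1]

/-- The exponent of the sign in `e_l² = ±1` for a list of one-based indices. -/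
def listSqExp (p : ℕ) (l : List ℕ) : ℕ := l.length.choose 2 + (l.filter (p < ·)).length

/-- The exponent of the sign in `e_l e_m = ± e_m e_l` for lists of one-based indices. -/
def listComExp (l m : List ℕ) : ℕ := l.length * m.length + (l.filter (· ∈ m)).length

theorem ValidList.sqExp_idx {p q : ℕ} {l : List ℕ} (h : ValidList (p + q) l) :
    sqExp p (idx p q l) = listSqExp p l := by
  unfold sqExp listSqExp
  rw [h.card_idx, ← (h.filter (p < ·)).card_idx]
  congr 2
  ext i
  simp [mem_idx]

theorem ValidList.veeMonomial_commute_iff {p q : ℕ} {l m : List ℕ} (hl : ValidList (p + q) l)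
    (hm : ValidList (p + q) m) :
    veeMonomial p q (idx p q l) * veeMonomial p q (idx p q m) =
      veeMonomial p q (idx p q m) * veeMonomial p q (idx p q l) ↔ listComExp l m % 2 = 0 := by
  have h : idx p q l ∩ idx p q m = idx p q (l.filter (· ∈ m)) := by
    ext i
    simp [mem_idx]
  rw [VeeStab.veeMonomial_commute_iff, h, (hl.filter _).card_idx, hl.card_idx, hm.card_idx,
    listComExp]

theorem ValidList.veeMonomial_mul_self_eq_one_iff {p q : ℕ} {l : List ℕ}
    (hl : ValidList (p + q) l) :
    veeMonomial p q (idx p q l) * veeMonomial p q (idx p q l) = 1 ↔ listSqExp p l % 2 = 0 := by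
  rw [VeeStab.veeMonomial_mul_self_eq_one_iff, hl.sqExp_idx]

theorem ValidList.veeMonomial_ne_one {p q : ℕ} {l : List ℕ} (hl : ValidList (p + q) l)
    (h : l ≠ []) : veeMonomial p q (idx p q l) ≠ 1 := by
  intro h1
  rw [← veeMonomial_empty] at h1
  have h2 : idx p q l = ∅ := eq_of_signEq_monomial
    (Or.inl (congrArg (fun g : veeGroup p q => ((g : (Cl p q)ˣ) : Cl p q)) h1))
  have h3 := hl.card_idx
  rw [h2, Finset.card_empty] at h3
  exact h (List.length_eq_zero_iff.1 h3.symm)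

/-! ### Independence -/

/-- Each list contains an index which is not in any of the later lists. -/
def Triangular : List (List ℕ) → Prop
  | [] => True
  | l :: L => (∃ x ∈ l, ∀ m ∈ L, x ∉ m) ∧ Triangular L

instance decidableTriangular : (L : List (List ℕ)) → Decidable (Triangular L)
  | [] => inferInstanceAs (Decidable True)
  | _ :: L =>
    haveI := decidableTriangular L
    inferInstanceAs (Decidable (_ ∧ _))

/-- The private index of the head monomial gives a character that is `1` on `-1` and on all later
monomials but `-1` on the head. Each new monomial therefore at least doubles the group. -/
theorem two_pow_le_card_closure {p q : ℕ} {L : List (List ℕ)}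
    (hv : ∀ l ∈ L, ValidList (p + q) l) (hL : Triangular L) :
    2 ^ (L.length + 1) ≤ Nat.card (Subgroup.closure
      {g : veeGroup p q | g = veeNegOne p q ∨ ∃ l ∈ L, g = veeMonomial p q (idx p q l)}) := by
  induction L with
  | nil =>
    rw [show {g : veeGroup p q | g = veeNegOne p q ∨ ∃ l ∈ [], g = veeMonomial p q (idx p q l)} =
      {veeNegOne p q} by ext; simp, ← Subgroup.zpowers_eq_closure, Nat.card_zpowers,
      orderOf_eq_prime (p := 2) (by rw [pow_two, veeNegOne_mul_self]) (veeNegOne_ne_one p q)]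
    rfl
  | cons l L ih =>
    obtain ⟨⟨x, hxl, hxL⟩, hL'⟩ := hL
    have ih := ih (fun l hl => hv l (List.mem_cons_of_mem _ hl)) hL'
    obtain ⟨hx1, hx2⟩ := (hv l List.mem_cons_self).2 x hxl
    set S := {g : veeGroup p q | g = veeNegOne p q ∨ ∃ l ∈ L, g = veeMonomial p q (idx p q l)}
    set S' := {g : veeGroup p q |
      g = veeNegOne p q ∨ ∃ m ∈ l :: L, g = veeMonomial p q (idx p q m)}
    have hSS : Subgroup.closure S ≤ Subgroup.closure S' := by
      refine Subgroup.closure_mono ?_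
      rintro g (hg | ⟨m, hm, hg⟩)
      · exact Or.inl hg
      · exact Or.inr ⟨m, List.mem_cons_of_mem _ hm, hg⟩
    obtain ⟨φ, hφ1, hφ2⟩ := exists_veeSign p q ⟨x - 1, by omega⟩
    have hker : Subgroup.closure S ≤ φ.ker := by
      rw [Subgroup.closure_le]
      rintro g (rfl | ⟨m, hm, rfl⟩)
      · exact hφ1
      · refine (hφ2 _).trans (if_neg ?_)
        rw [mem_idx]
        simpa [Nat.sub_add_cancel hx1] using hxL m hm
    have hmem : veeMonomial p q (idx p q l) ∈ Subgroup.closure S' :=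
      Subgroup.subset_closure (Or.inr ⟨l, List.mem_cons_self, rfl⟩)
    have hnot : veeMonomial p q (idx p q l) ∉ Subgroup.closure S := by
      intro h
      have h1 := hker h
      rw [MonoidHom.mem_ker, hφ2, if_pos] at h1
      · exact absurd h1 (by decide)
      · rw [mem_idx]
        simpa [Nat.sub_add_cancel hx1] using hxl
    obtain ⟨c, hc⟩ := Subgroup.card_dvd_of_le hSS
    have hpos : 0 < Nat.card (Subgroup.closure S') := Nat.card_pos
    have hc2 : 2 ≤ c := by
      by_contra hlt
      have : c = 0 ∨ c = 1 := by omega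
      rcases this with rfl | rfl
      · omega
      · exact hnot ((Subgroup.eq_of_le_of_card_ge hSS (by omega)).symm ▸ hmem)
    rw [hc, List.length_cons, pow_succ]
    exact Nat.mul_le_mul ih hc2

theorem card_closure_le {G : Type*} [Group G] [Finite G] {L : List G}
    (hsq : ∀ a ∈ L, a * a = 1) (hcomm : ∀ a ∈ L, ∀ b ∈ L, a * b = b * a) :
    Nat.card (Subgroup.closure {g | g ∈ L}) ≤ 2 ^ L.length := by
  induction L with
  | nil => simp
  | cons a L ih =>
    have ih := ih (fun x hx => hsq x (List.mem_cons_of_mem _ hx))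
      fun x hx y hy => hcomm x (List.mem_cons_of_mem _ hx) y (List.mem_cons_of_mem _ hy)
    set K := Subgroup.closure {g | g ∈ L}
    have haK : a ∈ Subgroup.centralizer (K : Set G) := by
      rw [Subgroup.centralizer_closure, Subgroup.mem_centralizer_iff]
      exact fun b hb => hcomm b (List.mem_cons_of_mem _ hb) a List.mem_cons_self
    let φ := (Subgroup.zpowers a).subtype.noncommCoprod K.subtype (by
      rintro ⟨_, n, rfl⟩ ⟨k, hk⟩
      exact (Commute.zpow_right (Subgroup.mem_centralizer_iff.1 haK k hk) n).symm)
    have hr : φ.range = Subgroup.closure {g | g ∈ a :: L} := by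
      rw [MonoidHom.noncommCoprod_range, Subgroup.range_subtype, Subgroup.range_subtype,
        Subgroup.zpowers_eq_closure, ← Subgroup.closure_union]
      congr 1
      ext x
      simp
    have h1 : Nat.card φ.range ≤ Nat.card (Subgroup.zpowers a × K) :=
      Nat.card_le_card_of_surjective _ φ.rangeRestrict_surjective
    have h2 : Nat.card (Subgroup.zpowers a) ≤ 2 := by
      rw [Nat.card_zpowers]
      exact orderOf_le_of_pow_eq_one (by norm_num)
        (by rw [pow_two, hsq a List.mem_cons_self])
    rw [hr, Nat.card_prod] at h1
    rw [List.length_cons, pow_succ, mul_comm]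
    exact h1.trans (Nat.mul_le_mul h2 ih)

/-- Flipping the private index of the head fixes the product `f` of the later factors and turns `(1
+ e) f = 0` into `(1 - e) f = 0`; together these give `f = 0`. -/
theorem list_prod_ne_zero {p q : ℕ} {L : List (List ℕ)}
    (hv : ∀ l ∈ L, ValidList (p + q) l) (hL : Triangular L) :
    (L.map fun l => (1 / 2 : ℝ) • (1 + monomial p q (idx p q l))).prod ≠ 0 := by
  induction L with
  | nil => simp
  | cons l L ih =>
    obtain ⟨⟨x, hxl, hxL⟩, hL'⟩ := hL
    have ih := ih (fun l hl => hv l (List.mem_cons_of_mem _ hl)) hL'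
    obtain ⟨hx1, hx2⟩ := (hv l List.mem_cons_self).2 x hxl
    set f := (L.map fun l => (1 / 2 : ℝ) • (1 + monomial p q (idx p q l))).prod with hf
    have hfix : flip p q ⟨x - 1, by omega⟩ f = f := by
      rw [hf, map_list_prod, List.map_map]
      congr 1
      refine List.map_congr_left fun m hm => ?_
      have : (⟨x - 1, by omega⟩ : Fin (p + q)) ∉ idx p q m := by
        rw [mem_idx]
        simpa [Nat.sub_add_cancel hx1] using hxL m hm
      simp [flip_monomial, this]
    rw [List.map_cons, List.prod_cons, smul_mul_assoc, add_mul, one_mul]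
    intro h
    have h1 : f + monomial p q (idx p q l) * f = 0 :=
      (smul_eq_zero.1 h).resolve_left (by norm_num)
    have h2 := congrArg (flip p q ⟨x - 1, by omega⟩) h1
    have h3 : (⟨x - 1, by omega⟩ : Fin (p + q)) ∈ idx p q l := by
      rw [mem_idx]
      simpa [Nat.sub_add_cancel hx1] using hxl
    rw [map_add, map_mul, hfix, flip_monomial, if_pos h3, map_zero, neg_mul] at h2
    have h4 : f = -f := by
      nth_rewrite 1 [eq_neg_of_add_eq_zero_left h1]
      rw [add_neg_eq_zero.1 h2]
      simp only [← add_neg_eq_zero.1 h2]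
    exact ih (eq_zero_of_eq_neg h4)

/-! ### Verification of table rows -/

namespace TableRow

/-- The listed generators other than `-1`. -/
def genLists (R : TableRow) : List (List ℕ) := R.gens.filterMap id

/-- The isomorphism type is the one determined by `n - 2k`. -/
def shapeCheck (R : TableRow) : Bool :=
  match R.shape with
  | .elementary a => R.p + R.q = 2 * R.monomials.length ∧ a = R.monomials.length + 1
  | .withC4 a => R.p + R.q = 2 * R.monomials.length + 1 ∧ a = R.monomials.length
  | .f2 a => R.p + R.q = 2 * R.monomials.length + 2 ∧ a = R.monomials.length
  | .f3 a => R.p + R.q = 2 * R.monomials.length + 2 ∧ a + 1 = R.monomials.length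

/-- The order of a listed generator. -/
def genOrder (R : TableRow) : Option (List ℕ) → ℕ
  | none => 2
  | some l => if listSqExp R.p l % 2 = 0 then 2 else 4

/-- The finite conditions to be checked for a row. -/
def Check (R : TableRow) : Prop :=
  (R.p + R.q ≤ 9 ∧ ((R.p : ℤ) - R.q) % 4 ≠ 1 ∧
    (R.monomials.length : ℤ) = (R.q : ℤ) - radonHurwitz ((R.q : ℤ) - R.p)) ∧
  ((∀ l ∈ R.monomials, ValidList (R.p + R.q) l ∧ listSqExp R.p l % 2 = 0) ∧
    (∀ l ∈ R.monomials, ∀ m ∈ R.monomials, listComExp l m % 2 = 0) ∧ Triangular R.monomials) ∧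
  ((∀ l ∈ R.genLists, ValidList (R.p + R.q) l ∧ l ≠ []) ∧
    (∀ l ∈ R.genLists, ∀ m ∈ R.monomials, listComExp l m % 2 = 0) ∧ Triangular R.genLists ∧
    R.genLists.length + R.monomials.length = R.p + R.q ∧
    (none ∈ R.gens ∨ ∃ l ∈ R.genLists, listSqExp R.p l % 2 = 1)) ∧
  R.orders = R.gens.map R.genOrder ∧ R.shapeCheck = true

instance (R : TableRow) : Decidable R.Check := by
  unfold Check
  infer_instance

theorem check_realTable : ∀ R ∈ realTable, R.Check := by decide +kernel

theorem check_complexTable : ∀ R ∈ complexTable, R.Check := by decide +kernel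

theorem check_quaternionicTable : ∀ R ∈ quaternionicTable, R.Check := by decide +kernel

variable {R : TableRow}

theorem range_family (R : TableRow) :
    Set.range (fun j => veeMonomial R.p R.q (R.family j)) =
      {g | g ∈ R.monomials.map fun l => veeMonomial R.p R.q (idx R.p R.q l)} := by
  ext g
  simp only [Set.mem_range, Set.mem_ofPred_eq, List.mem_map, family]
  constructor
  · rintro ⟨j, rfl⟩
    exact ⟨_, List.get_mem _ _, rfl⟩
  · rintro ⟨l, hl, rfl⟩
    obtain ⟨j, rfl⟩ := List.get_of_mem hl
    exact ⟨j, rfl⟩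

theorem idem_ne_zero (h : R.Check) : R.idem ≠ 0 := by
  have h1 := list_prod_ne_zero (p := R.p) (q := R.q) (fun l hl => (h.2.1.1 l hl).1) h.2.1.2.2
  convert h1 using 1
  unfold idem productElt family
  congr 1
  conv_rhs => rw [← List.ofFn_get R.monomials, List.map_ofFn]
  congr 1
  ext j
  simp

theorem card_familyGroup_le (h : R.Check) :
    Nat.card (familyGroup R.p R.q R.family) ≤ 2 ^ R.monomials.length := by
  have h1 := card_closure_le
    (L := R.monomials.map fun l => veeMonomial R.p R.q (idx R.p R.q l)) ?_ ?_
  · rwa [← range_family, List.length_map] at h1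
  · intro a ha
    obtain ⟨l, hl, rfl⟩ := List.mem_map.1 ha
    exact (h.2.1.1 l hl).1.veeMonomial_mul_self_eq_one_iff.2 (h.2.1.1 l hl).2
  · intro a ha b hb
    obtain ⟨l, hl, rfl⟩ := List.mem_map.1 ha
    obtain ⟨m, hm, rfl⟩ := List.mem_map.1 hb
    exact ((h.2.1.1 l hl).1.veeMonomial_commute_iff (h.2.1.1 m hm).1).2 (h.2.1.2.1 l hl m hm)

theorem two_pow_le_card_adjoin (h : R.Check) : 2 ^ (R.monomials.length + 1) ≤
    Nat.card ((veeLike R.p R.q).adjoin (familyGroup R.p R.q R.family)) := by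
  refine (two_pow_le_card_closure (fun l hl => (h.2.1.1 l hl).1) h.2.1.2.2).trans
    (Nat.le_of_dvd Nat.card_pos (Subgroup.card_dvd_of_le ?_))
  rw [Subgroup.closure_le]
  rintro g (rfl | ⟨l, hl, rfl⟩)
  · exact (veeLike R.p R.q).z_mem_adjoin _
  · refine (veeLike R.p R.q).le_adjoin _ ?_
    rw [familyGroup, range_family]
    exact Subgroup.subset_closure (List.mem_map.2 ⟨l, hl, rfl⟩)

/-- `k` commuting involutions generate at most `2^k` elements, whereas together with `-1`
independence gives at least `2^(k+1)`. -/
theorem negOne_notMem (h : R.Check) :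
    veeNegOne R.p R.q ∉ familyGroup R.p R.q R.family := by
  intro hmem
  have h1 := two_pow_le_card_adjoin h
  have h2 := card_familyGroup_le h
  rw [(veeLike R.p R.q).adjoin_eq_self hmem, pow_succ] at h1
  have : 0 < 2 ^ R.monomials.length := by positivity
  omega

theorem isCommutingFamily (h : R.Check) : IsCommutingFamily R.p R.q R.family where
  sq_eq_one j := by
    have h1 := h.2.1.1 _ (List.get_mem R.monomials j)
    exact congrArg (fun g : veeGroup R.p R.q => ((g : (Cl R.p R.q)ˣ) : Cl R.p R.q))
      (h1.1.veeMonomial_mul_self_eq_one_iff.2 h1.2)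
  comm i j := by
    have h1 := h.2.1.1 _ (List.get_mem R.monomials i)
    have h2 := h.2.1.1 _ (List.get_mem R.monomials j)
    exact congrArg (fun g : veeGroup R.p R.q => ((g : (Cl R.p R.q)ˣ) : Cl R.p R.q))
      ((h1.1.veeMonomial_commute_iff h2.1).2
        (h.2.1.2.1 _ (List.get_mem R.monomials i) _ (List.get_mem R.monomials j)))
  card := by
    have h1 := two_pow_le_card_adjoin h
    rw [(veeLike R.p R.q).card_adjoin (negOne_notMem h), pow_succ] at h1
    refine le_antisymm (card_familyGroup_le h) ?_
    change _ ≤ Nat.card (familyGroup R.p R.q R.family)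
    omega

theorem orderData (h : R.Check) : OrderData R.p R.q R.monomials.length R.family :=
  orderData_of_negOne_notMem h.1.1 h.1.2.1 h.1.2.2 (isCommutingFamily h) (negOne_notMem h)

theorem stab_eq (h : R.Check) : stab R.p R.q R.idem =
    Subgroup.centralizer (familyGroup R.p R.q R.family : Set (veeGroup R.p R.q)) :=
  (isCommutingFamily h).stab_eq_centralizer (idem_ne_zero h)

theorem mem_genLists {l : List ℕ} : l ∈ R.genLists ↔ some l ∈ R.gens := by
  simp [genLists]

/-- The listed elements centralize the family. With `-1` they are independent and, by `s + k = n`,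
generate at least `2^(n+1-k)` elements, the order of the centralizer. -/
theorem closure_genElts (h : R.Check) :
    Subgroup.closure {g | g ∈ R.genElts} = stab R.p R.q R.idem := by
  have hz := veeLike R.p R.q
  rw [stab_eq h]
  have hle : Subgroup.closure {g | g ∈ R.genElts} ≤
      Subgroup.centralizer (familyGroup R.p R.q R.family : Set (veeGroup R.p R.q)) := by
    rw [Subgroup.closure_le]
    intro g hg
    obtain ⟨o, ho, rfl⟩ := List.mem_map.1 hg
    cases o with
    | none => exact Subgroup.mem_centralizer_iff.2 fun x _ => hz.central x
    | some l =>
      have hl := mem_genLists.2 ho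
      rw [SetLike.mem_coe, Subgroup.centralizer_closure, range_family,
        Subgroup.mem_centralizer_iff]
      intro x hx
      obtain ⟨m, hm, rfl⟩ := List.mem_map.1 hx
      exact (((h.2.2.1.1 l hl).1.veeMonomial_commute_iff (h.2.1.1 m hm).1).2
        (h.2.2.1.2.1 l hl m hm)).symm
  refine Subgroup.eq_of_le_of_card_ge hle ?_
  have hmem : ∀ l ∈ R.genLists, veeMonomial R.p R.q (idx R.p R.q l) ∈
      Subgroup.closure {g | g ∈ R.genElts} := fun l hl =>
    Subgroup.subset_closure (List.mem_map.2 ⟨some l, mem_genLists.1 hl, rfl⟩)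
  -- Either `-1` is listed or it is the square of a listed generator of order 4.
  have hneg : veeNegOne R.p R.q ∈ Subgroup.closure {g | g ∈ R.genElts} := by
    rcases h.2.2.1.2.2.2.2 with h1 | ⟨l, hl, h1⟩
    · exact Subgroup.subset_closure (List.mem_map.2 ⟨none, h1, rfl⟩)
    · rw [← veeMonomial_mul_self_eq_negOne (I := idx R.p R.q l)
        (by rw [(h.2.2.1.1 l hl).1.sqExp_idx, h1])]
      exact Subgroup.mul_mem _ (hmem l hl) (hmem l hl)
  rw [(orderData h).card_centralizer,
    show R.p + R.q + 1 - R.monomials.length = R.genLists.length + 1 by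
      have := h.2.2.1.2.2.2.1
      omega]
  refine (two_pow_le_card_closure (fun l hl => (h.2.2.1.1 l hl).1) h.2.2.1.2.2.1).trans
    (Nat.le_of_dvd Nat.card_pos (Subgroup.card_dvd_of_le ?_))
  rw [Subgroup.closure_le]
  rintro g (rfl | ⟨l, hl, rfl⟩)
  · exact hneg
  · exact hmem l hl

theorem map_orderOf_genElts (h : R.Check) : R.genElts.map orderOf = R.orders := by
  have hz := veeLike R.p R.q
  rw [h.2.2.2.1, genElts, List.map_map]
  refine List.map_congr_left fun o ho => ?_
  cases o with
  | none =>
    show orderOf (veeNegOne R.p R.q) = 2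
    exact orderOf_eq_prime (by rw [pow_two, hz.mul_self]) hz.ne_one
  | some l =>
    have hl := h.2.2.1.1 l (mem_genLists.2 ho)
    show orderOf (veeMonomial R.p R.q (idx R.p R.q l)) = if listSqExp R.p l % 2 = 0 then 2 else 4
    split_ifs with h1
    · exact orderOf_eq_prime (by rw [pow_two, hl.1.veeMonomial_mul_self_eq_one_iff.2 h1])
        (hl.1.veeMonomial_ne_one hl.2)
    · exact hz.orderOf_of_mul_self (veeMonomial_mul_self_eq_negOne
        (by rw [hl.1.sqExp_idx]; omega))

end TableRow

/-! ### The group `F_3` -/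

theorem nonempty_cyclicPower_prod (a : ℕ) :
    Nonempty (CyclicPower 2 (a + 1) ≃* CyclicPower 2 1 × CyclicPower 2 a) := by
  have hsq : ∀ k, ∀ x : CyclicPower 2 k, x * x = 1 := fun k x => funext fun i => by
    have : ∀ y : Multiplicative (ZMod 2), y * y = 1 := by decide
    exact this (x i)
  have hc : ∀ k, Nat.card (CyclicPower 2 k) = 2 ^ k := fun k => by
    rw [Nat.card_eq_fintype_card]
    simp
  obtain ⟨φ⟩ := nonempty_mulEquiv_cyclicPower_two (H := CyclicPower 2 1 × CyclicPower 2 a)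
    (k := a + 1) (fun x => Prod.ext (hsq _ _) (hsq _ _)) (by
      rw [Nat.card_prod, hc, hc, ← pow_add, add_comm])
  exact ⟨φ.symm⟩

/-- `F_3` is the stabilizer in the `(0,4)` row, to which the general quaternionic case applies with
`k = 1`. Only the generators of that row are used, not its isomorphism type, so there is no
circularity. -/
theorem nonempty_F3_mulEquiv : Nonempty (F3 ≃* F2 × CyclicPower 2 1) := by
  have h := TableRow.check_quaternionicTable _ List.mem_cons_self
  obtain ⟨φ⟩ := (TableRow.orderData h).mulEquiv_quaternionic (TableRow.isCommutingFamily h) rfl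
  rw [← TableRow.stab_eq h, ← TableRow.closure_genElts h] at φ
  have h1 : F3 = Subgroup.closure {g | g ∈ (quaternionicRow 0 4 [[1, 2, 3]]
      [[1], [2], [3]] [4, 4, 4] (.f3 0)).genElts} := by
    unfold F3
    congr 1
    ext g
    change _ ↔ g ∈ [veeMonomial 0 4 (idx 0 4 [1]), veeMonomial 0 4 (idx 0 4 [2]),
      veeMonomial 0 4 (idx 0 4 [3])]
    simp
  rw [h1]
  exact ⟨φ⟩

theorem card_F3 : Nat.card F3 = 16 := by
  obtain ⟨φ⟩ := nonempty_F3_mulEquiv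
  rw [Nat.card_congr φ.toEquiv, Nat.card_prod, card_F2, Nat.card_eq_fintype_card]
  simp

theorem TableRow.describes {R : TableRow} (h : R.Check) :
    R.shape.Describes (stab R.p R.q R.idem) := by
  have D := orderData h
  have hI := isCommutingFamily h
  have hs := h.2.2.2.2
  rw [stab_eq h]
  unfold shapeCheck at hs
  rcases hsh : R.shape with a | a | a | a <;> rw [hsh] at hs <;>
    obtain ⟨h1, h2⟩ := of_decide_eq_true hs
  · subst h2
    exact D.mulEquiv_real hI h1
  · subst h2
    exact D.mulEquiv_complex hI h1
  · subst h2
    exact D.mulEquiv_quaternionic hI h1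
  -- Here `k = a + 1`: one factor of order 2 is split off and absorbed with `F_2` into `F_3`.
  · obtain ⟨φ⟩ := D.mulEquiv_quaternionic hI h1
    obtain ⟨ψ⟩ := nonempty_F3_mulEquiv
    obtain ⟨χ⟩ := nonempty_cyclicPower_prod a
    rw [h2] at χ
    exact ⟨(φ.trans (MulEquiv.prodCongr (MulEquiv.refl F2) χ)).trans
      (MulEquiv.prodAssoc.symm.trans (MulEquiv.prodCongr ψ.symm (MulEquiv.refl _)))⟩

theorem TableRow.correct {R : TableRow} (h : R.Check) : R.Correct where
  family := isCommutingFamily h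
  length := h.1.2.2
  gens := closure_genElts h
  orders := map_orderOf_genElts h
  shape := describes h

theorem not_comm_of_mulEquiv {H : Type*} [Group H] {k : ℕ} (φ : H ≃* F2 × CyclicPower 2 k) :
    ¬ ∀ a b : H, a * b = b * a := by
  intro h
  refine F2_not_comm fun a b => ?_
  have h1 := congrArg φ (h (φ.symm (a, 1)) (φ.symm (b, 1)))
  simpa using h1

theorem comm_of_mulEquiv {H A : Type*} [Group H] [CommGroup A] (φ : H ≃* A) (a b : H) :
    a * b = b * a :=
  φ.injective (by rw [map_mul, map_mul, mul_comm])

theorem F2_le_stab :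
    F2 ≤ stab 1 3 (productElt 1 3 (fun _ : Fin 1 => idx 1 3 [1, 4]) fun _ => 1) := by
  unfold F2
  rw [Subgroup.closure_le]
  rintro g (rfl | rfl) <;>
  · refine IsCommutingFamily.mem_stab_iff.2 (commute_productElt fun _ => ?_)
    refine congrArg (fun g : veeGroup 1 3 => ((g : (Cl 1 3)ˣ) : Cl 1 3))
      (veeMonomial_commute_iff.2 ?_)
    decide

theorem negOne_mem_F2 : veeNegOne 1 3 ∈ F2 := by
  have h : veeMonomial 1 3 (idx 1 3 [2]) ∈ F2 := Subgroup.subset_closure (Or.inl rfl)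
  rw [← F2_mul_self 2 (Or.inl rfl)]
  exact F2.mul_mem h h

end VeeStab

end

/-! ### Assembly of the theorem -/

open VeeStab in
theorem mainTheorem2 :
    (∀ (p q k : ℕ), p + q ≤ 9 → ((p : ℤ) - q) % 4 ≠ 1 →
      (k : ℤ) = (q : ℤ) - radonHurwitz ((q : ℤ) - p) →
      ∀ (I : Fin k → Finset (Fin (p + q))) (ε : Fin k → ℤˣ) (f : Cl p q),
        IsCommutingFamily p q I → f = productElt p q I ε → IsPrimitiveIdempotent f →
        -- normality and order
        (stab p q f).Normal ∧
        (Nat.card (stab p q f) : ℚ) = (2 : ℚ) ^ (1 + (p : ℤ) + radonHurwitz ((q : ℤ) - p)) ∧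
        -- real simple case
        (((p : ℤ) - q) % 8 ∈ ({0, 1, 2} : Set ℤ) →
          IsPGroup 2 (stab p q f) ∧ (∀ a b : stab p q f, a * b = b * a) ∧
          (∃ g : Fin (k + 1) → stab p q f, Subgroup.closure (Set.range g) = ⊤ ∧
            ∀ i, orderOf (g i) = 2 ∨ orderOf (g i) = 4) ∧
          Nonempty (stab p q f ≃* CyclicPower 2 (k + 1))) ∧
        -- complex simple case
        (((p : ℤ) - q) % 8 ∈ ({3, 7} : Set ℤ) →
          IsPGroup 2 (stab p q f) ∧ (∀ a b : stab p q f, a * b = b * a) ∧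
          (∃ g : Fin (k + 1) → stab p q f, Subgroup.closure (Set.range g) = ⊤ ∧
            ∀ i, orderOf (g i) = 2 ∨ orderOf (g i) = 4) ∧
          Nonempty (stab p q f ≃* CyclicPower 2 k × Multiplicative (ZMod 4))) ∧
        -- quaternionic simple case
        (((p : ℤ) - q) % 8 ∈ ({4, 5, 6} : Set ℤ) →
          IsPGroup 2 (stab p q f) ∧ (¬ ∀ a b : stab p q f, a * b = b * a) ∧
          (∃ g : Fin (k + 2) → stab p q f, Subgroup.closure (Set.range g) = ⊤ ∧
            ∀ i, orderOf (g i) = 2 ∨ orderOf (g i) = 4) ∧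
          Nonempty (stab p q f ≃* F2 × CyclicPower 2 k)) ∧
        -- the monomials in `f` are fixed one by one
        (∀ m ∈ stab p q f, ∀ j, m * veeMonomial p q (I j) * m⁻¹ = veeMonomial p q (I j))) ∧
    -- the tables
    (∀ R ∈ realTable, R.Correct) ∧
    (∀ R ∈ complexTable, R.Correct) ∧
    (∀ R ∈ quaternionicTable, R.Correct) ∧
    -- the groups `F_2` and `F_3` of the quaternionic table
    Nat.card F2 = 8 ∧ Nat.card F3 = 16 ∧
    F2 ≤ stab 1 3 (productElt 1 3 (fun _ : Fin 1 => idx 1 3 [1, 4]) fun _ => 1) ∧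
    (F2.subgroupOf
      (stab 1 3 (productElt 1 3 (fun _ : Fin 1 => idx 1 3 [1, 4]) fun _ => 1))).Normal := by
  refine ⟨?_, fun R hR => TableRow.correct (TableRow.check_realTable R hR),
    fun R hR => TableRow.correct (TableRow.check_complexTable R hR),
    fun R hR => TableRow.correct (TableRow.check_quaternionicTable R hR), card_F2, card_F3, F2_le_stab,
    ((veeLike 1 3).normal_of_mem negOne_mem_F2).subgroupOf _⟩
  rintro p q k h9 hpq hk I ε f hI rfl hf
  have D := orderData_of_isPrimitiveIdempotent h9 hpq hk hI hf
  rw [hI.stab_eq_centralizer hf.1]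
  refine ⟨(veeLike p q).normal_of_mem (OrderData.adjoin_le hI ((veeLike p q).z_mem_adjoin _)), ?_, fun h => ?_, fun h => ?_, fun h => ?_, ?_⟩
  -- Since `k ≤ p + q`, the natural exponent `p + q + 1 - k` agrees with the integer `1 + p +
  -- r_{q-p}` after substituting `k = q - r_{q-p}`.
  · obtain ⟨hkn, -⟩ := re_eq_of_radonHurwitz h9 hpq hk
    rw [D.card_centralizer, Nat.cast_pow, Nat.cast_ofNat, ← zpow_natCast]
    congr 1
    omega
  · obtain ⟨φ⟩ := D.mulEquiv_real hI (radonHurwitz_real hpq hk h)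
    exact ⟨D.isPGroup, comm_of_mulEquiv φ, (HasGenerators.cyclicPower (k + 1)).of_mulEquiv φ, ⟨φ⟩⟩
  · obtain ⟨φ⟩ := D.mulEquiv_complex hI (radonHurwitz_complex hk h)
    exact ⟨D.isPGroup, comm_of_mulEquiv φ,
      ((HasGenerators.cyclicPower k).prod (HasGenerators.zmod (Or.inr rfl))).of_mulEquiv φ, ⟨φ⟩⟩
  · obtain ⟨φ⟩ := D.mulEquiv_quaternionic hI (radonHurwitz_quaternionic hpq hk h)
    have h1 := (F2_hasGenerators.prod (HasGenerators.cyclicPower k)).of_mulEquiv φ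
    rw [add_comm 2 k] at h1
    exact ⟨D.isPGroup, not_comm_of_mulEquiv φ, h1, ⟨φ⟩⟩
  · intro m hm j
    rw [Subgroup.mem_centralizer_iff] at hm
    rw [← hm _ (Subgroup.subset_closure ⟨j, rfl⟩), mul_inv_cancel_right]
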